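/- Let $1\le k\le n$ be integers. Let $\mathrm{O}(n)$ be the group of orthogonal $n\times n$ matrices, $\mathrm{V}(k,n)=\{Y\in\mathbb{R}^{n\times k}: Y^{\mathsf T}Y=I_k\}$, $\mathbb{R}^{n\times k}_k=\{A\in\mathbb{R}^{n\times k}:\operatorname{rank}A=k\}$ and $I_{k,n-k}=\operatorname{diag}(I_k,-I_{n-k})$. Consider the involution model and the projection model $$\mathcal{I}=\{Q\in \mathrm{O}(n): Q^{\mathsf T}=Q,\ \operatorname{tr}Q=2k-n\},\qquad \mathcal{P}=\{P\in\mathbb{R}^{n\times n}: P^{\mathsf T}=P=P^2,\ \operatorname{tr}P=k\},$$ and the quotients $\mathrm{O}(n)/(\mathrm{O}(k)\times \mathrm{O}(n-k))$, $\mathrm{V}(k,n)/\mathrm{O}(k)$ and $\mathbb{R}^{n\times k}_k/\mathrm{GL}(k)$, whose points are the classes $$[\![V]\!]=\Bigl\{V\begin{bmatrix}Q_1&0\\0&Q_2\end{bmatrix}: Q_1\in \mathrm{O}(k),\,Q_2\in \mathrm{O}(n-k)\Bigr\},\quad [\![Y]\!]=\{YQ:Q\in \mathrm{O}(k)\},\quad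 [\![A]\!]=\{AX:X\in\mathrm{GL}(k)\}.$$ The sets $\mathrm{O}(n)$, $\mathrm{V}(k,n)$, $\mathbb{R}^{n\times k}_k$, $\mathcal{I}$ and $\mathcal{P}$ are smooth embedded submanifolds of the spaces of matrices containing them, and the three quotients, with the quotient topology, have smooth structures for which the quotient maps are smooth submersions; $\mathcal{I}$, $\mathcal{P}$ and the three quotients have dimension $k(n-k)$. Every $Q\in\mathcal{I}$ can be written $Q=V_QI_{k,n-k}V_Q^{\mathsf T}$ with $V_Q\in \mathrm{O}(n)$; for any such $V_Q$, let $Y_Q\in \mathrm{V}(k,n)$ consist of its first $k$ columns. Every $A\in\mathbb{R}^{n\times k}_k$ has a QR factorization $A=Y_AR_A$ with $Y_A\in \mathrm{V}(k,n)$ and $R_A\in\mathbb{R}^{k\times k}$ upper triangular. With the above smooth structures, the following four maps are well defined (in particular independent of the choice of representatives and of $Y_A$) and are $C^\infty$ diffeomorphisms, with the indicated inverses (independent of the choice of $V_Q$): 1. $\varphi_1:\mathrm{O}(n)/(\mathrm{O}(k)\times \mathrm{O}(n-k))\to\mathcal{I}$, $\varphi_1([\![V]\!])=V I_{k,n-k}V^{\mathsf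 T}$, with $\varphi_1^{-1}(Q)=[\![V_Q]\!]$; 2. $\varphi_2:\mathcal{P}\to\mathcal{I}$, $\varphi_2(P)=2P-I$, with $\varphi_2^{-1}(Q)=\tfrac12(I+Q)$; 3. $\varphi_3:\mathrm{V}(k,n)/\mathrm{O}(k)\to\mathcal{I}$, $\varphi_3([\![Y]\!])=2YY^{\mathsf T}-I$, with $\varphi_3^{-1}(Q)=[\![Y_Q]\!]$; 4. $\varphi_4:\mathbb{R}^{n\times k}_k/\mathrm{GL}(k)\to\mathcal{I}$, $\varphi_4([\![A]\!])=2Y_AY_A^{\mathsf T}-I$, with $\varphi_4^{-1}(Q)=[\![Y_Q]\!]$. -/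

import Mathlib

open scoped Manifold ContDiff Matrix

namespace Grassmann

/-! ### The matrix models, as topological spaces -/

/-- The orthogonal group `O(n)`. -/
abbrev O (n : ℕ) : Type := Matrix.orthogonalGroup (Fin n) ℝ

/-- The set `V(k, n)` of `n × k` matrices with orthonormal columns. -/
abbrev V (k n : ℕ) : Type := {Y : Matrix (Fin n) (Fin k) ℝ // Yᵀ * Y = 1}

/-- The set of real `n × k` matrices of rank `k`. -/
abbrev FullRank (k n : ℕ) : Type := {A : Matrix (Fin n) (Fin k) ℝ // A.rank = k}

/-- The involution model: symmetric orthogonal matrices of trace `2k - n`. -/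
abbrev InvolutionModel (k n : ℕ) : Type :=
  {Q : Matrix (Fin n) (Fin n) ℝ //
    Q ∈ Matrix.orthogonalGroup (Fin n) ℝ ∧ Qᵀ = Q ∧ Q.trace = 2 * (k : ℝ) - (n : ℝ)}

/-- The projection model: orthogonal projection matrices of trace `k`. -/
abbrev ProjectionModel (k n : ℕ) : Type :=
  {P : Matrix (Fin n) (Fin n) ℝ // Pᵀ = P ∧ P * P = P ∧ P.trace = (k : ℝ)}

/-- The identification of `{0, …, k-1} ⊔ {0, …, n-k-1}` with `{0, …, n-1}` that puts the first
summand first. -/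
def blockEquiv {k n : ℕ} (h : k ≤ n) : Fin k ⊕ Fin (n - k) ≃ Fin n :=
  finSumFinEquiv.trans (finCongr (Nat.add_sub_of_le h))

/-- The matrix `I_{k,n-k} = diag(I_k, -I_{n-k})`. -/
def signature {k n : ℕ} (h : k ≤ n) : Matrix (Fin n) (Fin n) ℝ :=
  Matrix.reindex (blockEquiv h) (blockEquiv h) (Matrix.fromBlocks 1 0 0 (-1))

/-- The embedding `O(k) × O(n-k) → O(n)`, `(Q₁, Q₂) ↦ diag(Q₁, Q₂)`. -/
def blockDiag {k n : ℕ} (h : k ≤ n) : O k × O (n - k) →* O n where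
  toFun Q := ⟨Matrix.reindex (blockEquiv h) (blockEquiv h)
      (Matrix.fromBlocks (Q.1 : Matrix (Fin k) (Fin k) ℝ) 0 0
        (Q.2 : Matrix (Fin (n - k)) (Fin (n - k)) ℝ)), by
    have h1 := (Matrix.mem_orthogonalGroup_iff (Fin k) ℝ).1 Q.1.2
    have h2 := (Matrix.mem_orthogonalGroup_iff (Fin (n - k)) ℝ).1 Q.2.2
    rw [Matrix.mem_orthogonalGroup_iff]
    simp [Matrix.fromBlocks_transpose, Matrix.submatrix_mul_equiv, Matrix.fromBlocks_multiply,
      h1, h2, Matrix.fromBlocks_one]⟩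
  map_one' := by
    apply Subtype.ext
    simp [Matrix.fromBlocks_one]
  map_mul' Q R := by
    apply Subtype.ext
    simp [Matrix.submatrix_mul_equiv, Matrix.fromBlocks_multiply]

/-- The orthogonal model `O(n) / (O(k) × O(n-k))`: the class of `V` is the left coset
`{V diag(Q₁, Q₂)}`. It carries the quotient topology. -/
abbrev OrthogonalModel {k n : ℕ} (h : k ≤ n) : Type := O n ⧸ (blockDiag h).range

/-- The quotient map `V ↦ ⟦V⟧` onto the orthogonal model. -/
def orthogonalMk {k n : ℕ} (h : k ≤ n) (W : O n) : OrthogonalModel h := QuotientGroup.mk W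

/-- Two elements of `V(k, n)` are equivalent if they differ by right multiplication by an
element of `O(k)`. -/
def stiefelSetoid (k n : ℕ) : Setoid (V k n) where
  r Y Z := ∃ Q : O k, Z.1 = Y.1 * (Q : Matrix (Fin k) (Fin k) ℝ)
  iseqv :=
    { refl := fun Y => ⟨1, by simp⟩
      symm := by
        rintro Y Z ⟨Q, h⟩
        refine ⟨Q⁻¹, ?_⟩
        have : (Q : Matrix (Fin k) (Fin k) ℝ) * ((Q⁻¹ : O k) : Matrix (Fin k) (Fin k) ℝ) = 1 := by
          rw [← Submonoid.coe_mul, mul_inv_cancel, Submonoid.coe_one]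
        rw [h, Matrix.mul_assoc, this, Matrix.mul_one]
      trans := by
        rintro Y Z W ⟨Q, h⟩ ⟨R, h'⟩
        exact ⟨Q * R, by rw [h', h, Submonoid.coe_mul, Matrix.mul_assoc]⟩ }

/-- The Stiefel model `V(k, n) / O(k)`, with the quotient topology. -/
abbrev StiefelModel (k n : ℕ) : Type := Quotient (stiefelSetoid k n)

/-- The quotient map `Y ↦ ⟦Y⟧` onto the Stiefel model. -/
def stiefelMk {k n : ℕ} (Y : V k n) : StiefelModel k n := Quotient.mk (stiefelSetoid k n) Y

/-- Two full-rank matrices are equivalent if they differ by right multiplication by an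
element of `GL(k)`. -/
def fullRankSetoid (k n : ℕ) : Setoid (FullRank k n) where
  r A B := ∃ X : GL (Fin k) ℝ, B.1 = A.1 * (X : Matrix (Fin k) (Fin k) ℝ)
  iseqv :=
    { refl := fun A => ⟨1, by simp⟩
      symm := by
        rintro A B ⟨X, h⟩
        exact ⟨X⁻¹, by rw [h, Matrix.mul_assoc, Units.mul_inv, Matrix.mul_one]⟩
      trans := by
        rintro A B C ⟨X, h⟩ ⟨Z, h'⟩
        exact ⟨X * Z, by rw [h', h, Units.val_mul, Matrix.mul_assoc]⟩ }

/-- The full-rank model `ℝ^{n×k}_k / GL(k)`, with the quotient topology. -/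
abbrev FullRankModel (k n : ℕ) : Type := Quotient (fullRankSetoid k n)

/-- The quotient map `A ↦ ⟦A⟧` onto the full-rank model. -/
def fullRankMk {k n : ℕ} (A : FullRank k n) : FullRankModel k n :=
  Quotient.mk (fullRankSetoid k n) A

/-- The `n × k` matrix consisting of the first `k` columns of an orthogonal matrix. -/
def firstColumns {k n : ℕ} (h : k ≤ n) (W : O n) : V k n :=
  ⟨(W : Matrix (Fin n) (Fin n) ℝ).submatrix id (Fin.castLE h), by
    have hW := (Matrix.mem_orthogonalGroup_iff' (Fin n) ℝ).1 W.2
    rw [Matrix.transpose_submatrix, ← Matrix.submatrix_mul _ _ _ id _ Function.bijective_id, hW]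
    exact Matrix.submatrix_one _ (Fin.castLE_injective h)⟩

/-- The inclusion of `V(k, n)` in the set of `n × k` matrices of rank `k`. -/
def toFullRank {k n : ℕ} (Y : V k n) : FullRank k n :=
  ⟨Y.1, by rw [← Matrix.rank_transpose_mul_self, Y.2, Matrix.rank_one, Fintype.card_fin]⟩

/-- `A = Y R` is a QR factorization: `Y` has orthonormal columns and `R` is upper triangular. -/
def IsQR {k n : ℕ} (A : FullRank k n) (Y : V k n) (R : Matrix (Fin k) (Fin k) ℝ) : Prop :=
  R.BlockTriangular id ∧ A.1 = Y.1 * R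

/-! ### The smooth structures

The vector space `ℝ^{n×k}` of matrices is regarded as the normed space `Fin n → Fin k → ℝ` of
arrays of entries, so a matrix `A` is included in it as `fun i j => A i j`. -/

/-- The charts `c` make `M`, included in the vector space `E` by `ι`, a smooth embedded
submanifold of `E` of dimension `d` (without boundary). -/
structure IsSubmanifoldStructure (d : ℕ) {M E : Type} [TopologicalSpace M]
    [NormedAddCommGroup E] [NormedSpace ℝ E] (ι : M → E)
    (c : ChartedSpace (EuclideanSpace ℝ (Fin d)) M) : Prop where
  isManifold : IsManifold (𝓡 d) ∞ M
  isSmoothEmbedding : Manifold.IsSmoothEmbedding (𝓡 d) 𝓘(ℝ, E) ∞ ι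

/-- The charts `c` on the quotient space `N` make it the quotient manifold, of dimension `d`, of
the manifold `M` with charts `cM`: the quotient map `π : M → N` is a smooth submersion. -/
structure IsQuotientStructure (d : ℕ) {e : ℕ} {M N : Type} [TopologicalSpace M]
    [TopologicalSpace N] (π : M → N) (cM : ChartedSpace (EuclideanSpace ℝ (Fin e)) M)
    (c : ChartedSpace (EuclideanSpace ℝ (Fin d)) N) : Prop where
  isManifold : IsManifold (𝓡 d) ∞ N
  isSubmersion : Manifold.IsSubmersion (𝓡 e) (𝓡 d) ∞ π

/-- `c` is the smooth structure of the involution model as a submanifold of `ℝ^{n×n}`. -/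
def IsInvolutionStructure (k n : ℕ)
    (c : ChartedSpace (EuclideanSpace ℝ (Fin (k * (n - k)))) (InvolutionModel k n)) : Prop :=
  IsSubmanifoldStructure (k * (n - k))
    (fun (Q : InvolutionModel k n) (i : Fin n) (j : Fin n) => Q.1 i j) c

/-- `c` is the smooth structure of the projection model as a submanifold of `ℝ^{n×n}`. -/
def IsProjectionStructure (k n : ℕ)
    (c : ChartedSpace (EuclideanSpace ℝ (Fin (k * (n - k)))) (ProjectionModel k n)) : Prop :=
  IsSubmanifoldStructure (k * (n - k))
    (fun (P : ProjectionModel k n) (i : Fin n) (j : Fin n) => P.1 i j) c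

/-- `c` is the smooth structure of the orthogonal model as a quotient manifold of `O(n)`, which
has its structure `cO` of a submanifold of `ℝ^{n×n}`. -/
def IsOrthogonalStructure {k n : ℕ} (h : k ≤ n)
    (c : ChartedSpace (EuclideanSpace ℝ (Fin (k * (n - k)))) (OrthogonalModel h)) : Prop :=
  ∃ cO : ChartedSpace (EuclideanSpace ℝ (Fin (n * (n - 1) / 2))) (O n),
    IsSubmanifoldStructure (n * (n - 1) / 2)
      (fun (W : O n) (i : Fin n) (j : Fin n) => W.1 i j) cO ∧
    IsQuotientStructure (k * (n - k)) (orthogonalMk h) cO c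

/-- `c` is the smooth structure of the Stiefel model as a quotient manifold of `V(k, n)`, which
has its structure `cV` of a submanifold of `ℝ^{n×k}`. -/
def IsStiefelStructure (k n : ℕ)
    (c : ChartedSpace (EuclideanSpace ℝ (Fin (k * (n - k)))) (StiefelModel k n)) : Prop :=
  ∃ cV : ChartedSpace (EuclideanSpace ℝ (Fin (n * k - k * (k + 1) / 2))) (V k n),
    IsSubmanifoldStructure (n * k - k * (k + 1) / 2)
      (fun (Y : V k n) (i : Fin n) (j : Fin k) => Y.1 i j) cV ∧
    IsQuotientStructure (k * (n - k)) (stiefelMk : V k n → StiefelModel k n) cV c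

/-- `c` is the smooth structure of the full-rank model as a quotient manifold of the open
submanifold of matrices of rank `k` in `ℝ^{n×k}`. -/
def IsFullRankStructure (k n : ℕ)
    (c : ChartedSpace (EuclideanSpace ℝ (Fin (k * (n - k)))) (FullRankModel k n)) : Prop :=
  ∃ cF : ChartedSpace (EuclideanSpace ℝ (Fin (n * k))) (FullRank k n),
    IsSubmanifoldStructure (n * k)
      (fun (A : FullRank k n) (i : Fin n) (j : Fin k) => A.1 i j) cF ∧
    IsQuotientStructure (k * (n - k)) (fullRankMk : FullRank k n → FullRankModel k n) cF c

/-- `Q = W I_{k,n-k} Wᵀ` with `W` orthogonal: an eigenvalue decomposition of `Q`, whose first `k`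
columns are `1`-eigenvectors and whose last `n - k` columns are `-1`-eigenvectors. -/
def IsEigenbasis {k n : ℕ} (h : k ≤ n) (Q : InvolutionModel k n) (W : O n) : Prop :=
  (Q : Matrix (Fin n) (Fin n) ℝ) =
    (W : Matrix (Fin n) (Fin n) ℝ) * signature h * (W : Matrix (Fin n) (Fin n) ℝ)ᵀ

end Grassmann

/-! Each quotient is presented by a total space `M` (orthogonal, orthonormal or full-rank matrices)
with two maps: the quotient map `π`, and a surjection `Ψ` onto the involution model given by `W
I_{k,n-k} Wᵀ`, `2YYᵀ - 1` or `2A(AᵀA)⁻¹Aᵀ - 1`. The fibres of `Ψ` are exactly the classes, because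
each formula records the column space (the `1`-eigenspace) and nothing else. So `π` and `Ψ` induce a
bijection `φ` with `φ ∘ π = Ψ`, and it remains to see that `φ` and its inverse are smooth.

Near any point `φ` is `Ψ ∘ σ` with `σ` a local section of the submersion `π`, and `φ⁻¹` is `π ∘ σ`
with `σ` a local section of `Ψ`. Sections of `Ψ` come from the action of the orthogonal group: an
involution `Q` near `Q₀` is conjugate to `Q₀` by the square root of `Q Q₀` near `1`, which is
orthogonal and smooth in `Q` (`exists_local_conj`). Acting with it on a point over `Q₀` gives a
point over `Q`, since `Ψ` is equivariant. `IsQuotientModel` axiomatizes this situation,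
`isQuotientModel_of_equivariant` supplies it for the three quotients, and
`IsQuotientModel.exists_diffeomorph` draws the conclusion.

The smooth structures come from local parametrizations (`exists_isSubmanifoldStructure`):
projections are graphs over the range of a fixed one, involutions are their affine image,
orthonormal frames form a regular level set, and full-rank matrices form an open set. A quotient
receives the structure of the involution model through `φ`; the local sections of `Ψ` make `π` a
submersion. -/

namespace Grassmann

open Set Topology Filter

/-! ### Inverse function theorem and linear splittings. -/

section Calculus

variable {E F K : Type*} [NormedAddCommGroup E] [NormedSpace ℝ E] [NormedAddCommGroup F]
  [NormedSpace ℝ F] [NormedAddCommGroup K] [NormedSpace ℝ K]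

/-- The inverse function theorem, with a local inverse that is smooth on its whole domain. -/
theorem exists_smooth_localInverse [CompleteSpace E] {f : E → F} {U : Set E} (hU : IsOpen U)
    (hf : ContDiffOn ℝ ∞ f U) {a : E} (ha : a ∈ U) {f' : E ≃L[ℝ] F}
    (hf' : HasFDerivAt f (f' : E →L[ℝ] F) a) :
    ∃ Φ : OpenPartialHomeomorph E F, (∀ x, Φ x = f x) ∧ a ∈ Φ.source ∧ Φ.source ⊆ U ∧
      ContDiffOn ℝ ∞ Φ Φ.source ∧ ContDiffOn ℝ ∞ Φ.symm Φ.target := by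
  have hfa : ContDiffAt ℝ ∞ f a := hf.contDiffAt (hU.mem_nhds ha)
  let Φ₀ := hfa.toOpenPartialHomeomorph f hf' (by simp)
  have hΦ₀ : ∀ x, Φ₀ x = f x := fun x => rfl
  have hcont : ContinuousOn (fderiv ℝ f) U := hf.continuousOn_fderiv_of_isOpen hU (by simp)
  -- Invertibility of the derivative is an open condition; restricting to this set makes the inverse
  -- smooth on the entire target, not only at `f a`.
  have hopen : IsOpen (U ∩ fderiv ℝ f ⁻¹' range ((↑) : (E ≃L[ℝ] F) → E →L[ℝ] F)) :=
    hcont.isOpen_inter_preimage hU (ContinuousLinearEquiv.isOpen (𝕜 := ℝ))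
  set V := U ∩ fderiv ℝ f ⁻¹' range ((↑) : (E ≃L[ℝ] F) → E →L[ℝ] F)
  have haV : a ∈ V := ⟨ha, f', hf'.fderiv.symm⟩
  refine ⟨Φ₀.restrOpen V hopen, hΦ₀, ?_, ?_, ?_, ?_⟩
  · exact ⟨hfa.mem_toOpenPartialHomeomorph_source hf' (by simp), haV⟩
  · exact fun x hx => hx.2.1
  · exact hf.mono fun x hx => hx.2.1
  · intro y hy
    refine ContDiffAt.contDiffWithinAt ?_
    have hx := (Φ₀.restrOpen V hopen).map_target hy
    obtain ⟨-, hxU, e, he⟩ := hx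
    have hd : ContDiffAt ℝ ∞ f ((Φ₀.restrOpen V hopen).symm y) := hf.contDiffAt (hU.mem_nhds hxU)
    refine (Φ₀.restrOpen V hopen).contDiffAt_symm (f₀' := e) hy ?_ hd
    rw [he]
    exact (hd.differentiableAt (by simp)).hasFDerivAt

/-- A split surjection of finite-dimensional spaces is a projection up to an isomorphism. -/
theorem exists_splitting [FiniteDimensional ℝ E] [FiniteDimensional ℝ F] [FiniteDimensional ℝ K]
    (q : E →L[ℝ] F) (s : F →L[ℝ] E) (hqs : ∀ w, q (s w) = w)
    (hdim : Module.finrank ℝ E = Module.finrank ℝ F + Module.finrank ℝ K) :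
    ∃ e : E ≃L[ℝ] F × K, (∀ y, (e y).1 = q y) ∧ ∀ w, e (s w) = (w, 0) := by
  have hker : Module.finrank ℝ (LinearMap.ker (q : E →ₗ[ℝ] F)) = Module.finrank ℝ K := by
    have h1 := LinearMap.finrank_range_add_finrank_ker (q : E →ₗ[ℝ] F)
    have h2 : LinearMap.range (q : E →ₗ[ℝ] F) = ⊤ :=
      LinearMap.range_eq_top.2 fun w => ⟨s w, hqs w⟩
    rw [h2, finrank_top] at h1
    omega
  let κ : LinearMap.ker (q : E →ₗ[ℝ] F) ≃ₗ[ℝ] K := LinearEquiv.ofFinrankEq _ _ hker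
  -- `ρ` is the projection onto `ker q` along the image of `s`; it supplies the second coordinate
  -- and kills `s w`.
  let ρ : E →ₗ[ℝ] LinearMap.ker (q : E →ₗ[ℝ] F) :=
    LinearMap.codRestrict _ (LinearMap.id - (s : F →ₗ[ℝ] E) ∘ₗ (q : E →ₗ[ℝ] F)) fun y => by
      simp [hqs]
  let L : E →ₗ[ℝ] F × K := (q : E →ₗ[ℝ] F).prod (κ.toLinearMap ∘ₗ ρ)
  have hL : Function.Injective L := by
    rw [← LinearMap.ker_eq_bot, LinearMap.ker_eq_bot']
    intro y hy
    have h1 : q y = 0 := congrArg Prod.fst hy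
    have h2 : κ (ρ y) = 0 := congrArg Prod.snd hy
    rw [LinearEquiv.map_eq_zero_iff] at h2
    have h3 : y - s (q y) = 0 := congrArg Subtype.val h2
    simpa [h1] using h3
  let e := LinearEquiv.ofInjectiveOfFinrankEq L hL (by rw [Module.finrank_prod, hdim])
  refine ⟨e.toContinuousLinearEquiv, fun y => rfl, fun w => ?_⟩
  have h : ρ (s w) = 0 := by
    apply Subtype.ext
    change s w - s (q (s w)) = 0
    rw [hqs, sub_self]
  change (q (s w), κ (ρ (s w))) = (w, 0)
  rw [h, hqs, map_zero]

end Calculus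

end Grassmann

namespace Grassmann

open Set Topology Filter

/-! ### Embedded submanifolds from local parametrizations. -/

section Submanifold

variable {E : Type} [NormedAddCommGroup E] [NormedSpace ℝ E]

/-- A smooth parametrization `p` of the subset `S` of `E` near the point `x`, by an open subset of
`ℝ^d`, whose inverse extends to a smooth map `r` on an open subset of `E`. -/
structure LocalParam (S : Set E) (d : ℕ) (x : E) where
  /-- The open subset of `E` on which the parametrization is inverted. -/
  U : Set E
  /-- The domain of the parametrization. -/
  W : Set (EuclideanSpace ℝ (Fin d))
  /-- The extension of the inverse of the parametrization. -/
  r : E → EuclideanSpace ℝ (Fin d)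
  /-- The parametrization. -/
  p : EuclideanSpace ℝ (Fin d) → E
  isOpen_U : IsOpen U
  isOpen_W : IsOpen W
  mem_U : x ∈ U
  contDiffOn_r : ContDiffOn ℝ ∞ r U
  contDiffOn_p : ContDiffOn ℝ ∞ p W
  r_mem : ∀ y ∈ U, y ∈ S → r y ∈ W
  p_mem_U : ∀ w ∈ W, p w ∈ U
  p_mem : ∀ w ∈ W, p w ∈ S
  r_p : ∀ w ∈ W, r (p w) = w
  p_r : ∀ y ∈ U, y ∈ S → p (r y) = y

variable {M : Type} [TopologicalSpace M] {ι : M → E} {d : ℕ}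

/-- The chart of a subset given by a local parametrization. -/
noncomputable def LocalParam.chart (hι : IsEmbedding ι) {x : M}
    (P : LocalParam (range ι) d (ι x)) : OpenPartialHomeomorph M (EuclideanSpace ℝ (Fin d)) where
  toFun y := P.r (ι y)
  invFun w := haveI : Nonempty M := ⟨x⟩; Function.invFun ι (P.p w)
  source := ι ⁻¹' P.U
  target := P.W
  map_source' y hy := P.r_mem _ hy (mem_range_self y)
  map_target' w hw := by
    have : Nonempty M := ⟨x⟩
    rw [mem_preimage, Function.invFun_eq (P.p_mem w hw)]
    exact P.p_mem_U w hw
  left_inv' y hy := by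
    have : Nonempty M := ⟨x⟩
    apply hι.injective
    rw [P.p_r _ hy (mem_range_self y)]
    exact Function.invFun_eq ⟨y, rfl⟩
  right_inv' w hw := by
    have : Nonempty M := ⟨x⟩
    rw [Function.invFun_eq (P.p_mem w hw), P.r_p w hw]
  open_source := P.isOpen_U.preimage hι.continuous
  open_target := P.isOpen_W
  continuousOn_toFun := P.contDiffOn_r.continuousOn.comp hι.continuous.continuousOn fun _ h => h
  continuousOn_invFun := by
    have : Nonempty M := ⟨x⟩
    rw [hι.isInducing.continuousOn_iff]
    exact P.contDiffOn_p.continuousOn.congr fun w hw => Function.invFun_eq (P.p_mem w hw)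

theorem LocalParam.apply_chart_symm (hι : IsEmbedding ι) {x : M}
    (P : LocalParam (range ι) d (ι x)) {w} (hw : w ∈ P.W) : ι ((P.chart hι).symm w) = P.p w :=
  haveI : Nonempty M := ⟨x⟩
  Function.invFun_eq (P.p_mem w hw)

theorem mem_contDiffGroupoid_of_contDiffOn {F : Type*} [NormedAddCommGroup F] [NormedSpace ℝ F]
    {e : OpenPartialHomeomorph F F} (h : ContDiffOn ℝ ∞ e e.source)
    (h' : ContDiffOn ℝ ∞ e.symm e.target) : e ∈ contDiffGroupoid ∞ 𝓘(ℝ, F) := by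
  rw [contDiffGroupoid, mem_groupoid_of_pregroupoid, contDiffPregroupoid]
  simpa using ⟨h, h'⟩

/-- A subset of a vector space with local parametrizations around each of its points is an
embedded submanifold. -/
theorem exists_isSubmanifoldStructure [FiniteDimensional ℝ E] (hι : IsEmbedding ι)
    (P : ∀ x : M, LocalParam (range ι) d (ι x)) : ∃ c, IsSubmanifoldStructure d ι c := by
  let c : ChartedSpace (EuclideanSpace ℝ (Fin d)) M :=
    { atlas := range fun x => (P x).chart hι
      chartAt := fun x => (P x).chart hι
      mem_chart_source := fun x => (P x).mem_U
      chart_mem_atlas := fun x => ⟨x, rfl⟩ }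
  have hman : IsManifold (𝓡 d) ∞ M := by
    refine isManifold_of_contDiffOn _ _ _ ?_
    rintro _ _ ⟨x, rfl⟩ ⟨y, rfl⟩
    simp only [modelWithCornersSelf_coe, modelWithCornersSelf_coe_symm, Function.id_comp,
      Function.comp_id, preimage_id, range_id, inter_univ]
    -- A change of charts is the ambient composite of one parametrization with the other's smooth
    -- retraction, so its smoothness needs nothing intrinsic to `M`.
    have hsub : (((P x).chart hι).symm.trans ((P y).chart hι)).source ⊆
        (P x).W ∩ (P x).p ⁻¹' (P y).U := by
      rintro w ⟨hw, hw'⟩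
      refine ⟨hw, ?_⟩
      have : ι (((P x).chart hι).symm w) ∈ (P y).U := hw'
      rwa [(P x).apply_chart_symm hι hw] at this
    refine ContDiffOn.congr (f := (P y).r ∘ (P x).p) ?_ ?_
    · exact (P y).contDiffOn_r.comp ((P x).contDiffOn_p.mono fun w hw => (hsub hw).1)
        fun w hw => (hsub hw).2
    · intro w hw
      change (P y).r (ι (((P x).chart hι).symm w)) = _
      rw [(P x).apply_chart_symm hι (hsub hw).1]
      rfl
  -- The truncated subtraction is a true codimension: `hle` below shows that `d` is at most the
  -- dimension of `E`.
  refine ⟨c, hman, ⟨EuclideanSpace ℝ (Fin (Module.finrank ℝ E - d)), inferInstance, inferInstance,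
    fun x => ?_⟩, hι⟩
  set A := P x
  set w₀ := A.r (ι x)
  have hw₀ : w₀ ∈ A.W := A.r_mem _ A.mem_U (mem_range_self x)
  have hpw₀ : A.p w₀ = ι x := A.p_r _ A.mem_U (mem_range_self x)
  have hdp : HasFDerivAt A.p (fderiv ℝ A.p w₀) w₀ :=
    ((A.contDiffOn_p.contDiffAt (A.isOpen_W.mem_nhds hw₀)).differentiableAt (by simp)).hasFDerivAt
  have hdr : HasFDerivAt A.r (fderiv ℝ A.r (ι x)) (A.p w₀) := by
    rw [hpw₀]
    exact ((A.contDiffOn_r.contDiffAt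
      (A.isOpen_U.mem_nhds A.mem_U)).differentiableAt (by simp)).hasFDerivAt
  have hqs : ∀ w, fderiv ℝ A.r (ι x) (fderiv ℝ A.p w₀ w) = w := by
    have h1 : HasFDerivAt (A.r ∘ A.p) (ContinuousLinearMap.id ℝ _) w₀ :=
      (hasFDerivAt_id w₀).congr_of_eventuallyEq
        (Filter.eventually_of_mem (A.isOpen_W.mem_nhds hw₀) A.r_p)
    exact fun w => DFunLike.congr_fun ((hdr.comp w₀ hdp).unique h1) w
  have hle : d ≤ Module.finrank ℝ E := by
    have := LinearMap.finrank_le_finrank_of_injective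
      (f := (fderiv ℝ A.p w₀ : EuclideanSpace ℝ (Fin d) →ₗ[ℝ] E))
      (Function.LeftInverse.injective hqs)
    simpa using this
  obtain ⟨e, -, he⟩ := exists_splitting (K := EuclideanSpace ℝ (Fin (Module.finrank ℝ E - d)))
    _ _ hqs (by simp; omega)
  have he0 : e.symm (0, (0 : EuclideanSpace ℝ (Fin (Module.finrank ℝ E - d)))) = 0 :=
    e.symm.map_zero
  -- The parametrization is thickened by a complement of its tangent space. The resulting map is a
  -- local diffeomorphism of `E`, and its inverse straightens the submanifold to `z = 0`.
  have hG : ContDiffOn ℝ ∞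
      (fun v : EuclideanSpace ℝ (Fin d) × EuclideanSpace ℝ (Fin (Module.finrank ℝ E - d)) =>
        A.p v.1 + e.symm (0, v.2)) (Prod.fst ⁻¹' A.W) := by
    refine (A.contDiffOn_p.comp contDiff_fst.contDiffOn fun v hv => hv).add ?_
    exact (e.symm.contDiff.comp (contDiff_const.prodMk contDiff_snd)).contDiffOn
  -- The splitting `e` sends the image of `w` under the derivative of `A.p` to `(w, 0)`, so the
  -- derivative of the thickened map is exactly `e.symm`.
  have hdG : HasFDerivAt
      (fun v : EuclideanSpace ℝ (Fin d) × EuclideanSpace ℝ (Fin (Module.finrank ℝ E - d)) =>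
        A.p v.1 + e.symm (0, v.2)) (e.symm : _ →L[ℝ] E) (w₀, 0) := by
    have h1 : HasFDerivAt (A.p ∘ Prod.fst) _ (w₀, (0 : EuclideanSpace ℝ (Fin _))) :=
      HasFDerivAt.comp (w₀, (0 : EuclideanSpace ℝ (Fin (Module.finrank ℝ E - d)))) hdp hasFDerivAt_fst
    have h2 := ((e.symm : _ →L[ℝ] E).comp
      (ContinuousLinearMap.prod (0 : _ →L[ℝ] EuclideanSpace ℝ (Fin d))
      (ContinuousLinearMap.snd ℝ (EuclideanSpace ℝ (Fin d))
        (EuclideanSpace ℝ (Fin (Module.finrank ℝ E - d)))))).hasFDerivAt (x := (w₀, 0))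
    refine (h1.add h2).congr_fderiv ?_
    ext1
    · ext1 w
      have h3 : e.symm (w, 0) = fderiv ℝ A.p w₀ w := by rw [← he, e.symm_apply_apply]
      simp [h3]
    · ext1 z
      simp
  obtain ⟨Φ, hΦ, hmem, hsub, hΦ1, hΦ2⟩ := exists_smooth_localInverse
    (A.isOpen_W.preimage continuous_fst) hG (show (w₀, 0) ∈ Prod.fst ⁻¹' A.W from hw₀) hdG
  have hO : IsOpen ((fun y : M => (A.chart hι y, (0 : EuclideanSpace ℝ (Fin (Module.finrank ℝ E - d)))))
      ⁻¹' Φ.source ∩ (A.chart hι).source) := by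
    rw [inter_comm]
    exact ContinuousOn.isOpen_inter_preimage
      ((A.chart hι).continuousOn.prodMk continuousOn_const) (A.chart hι).open_source Φ.open_source
  set O := (fun y : M => (A.chart hι y, (0 : EuclideanSpace ℝ (Fin (Module.finrank ℝ E - d)))))
      ⁻¹' Φ.source ∩ (A.chart hι).source
  have hxO : x ∈ O := ⟨hmem, A.mem_U⟩
  have hmax : A.chart hι ∈ IsManifold.maximalAtlas (𝓡 d) ∞ M :=
    IsManifold.subset_maximalAtlas ⟨x, rfl⟩
  have key : ∀ w ∈ ((A.chart hι).restr O).target,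
      w ∈ A.W ∧ (w, (0 : EuclideanSpace ℝ (Fin (Module.finrank ℝ E - d)))) ∈ Φ.source := by
    rintro w ⟨hw, hw'⟩
    refine ⟨hw, ?_⟩
    rw [hO.interior_eq] at hw'
    have := hw'.1
    rwa [mem_preimage, (A.chart hι).right_inv hw] at this
  refine Manifold.IsImmersionAtOfComplement.mk_of_continuousAt hι.continuous.continuousAt
    e.symm ((A.chart hι).restr O) (Φ.symm.trans e.symm.toHomeomorph.toOpenPartialHomeomorph)
    ⟨A.mem_U, ?_⟩ ?_
    (restr_mem_maximalAtlas _ hmax hO) ?_ ?_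
  · rw [hO.interior_eq]; exact hxO
  · have h : ι x ∈ Φ.target := by
      have := Φ.map_source hmem
      rwa [hΦ, he0, add_zero, hpw₀] at this
    exact ⟨h, mem_univ _⟩
  · apply StructureGroupoid.mem_maximalAtlas_of_mem_groupoid
    apply mem_contDiffGroupoid_of_contDiffOn
    · exact e.symm.contDiff.comp_contDiffOn (hΦ2.mono fun y hy => hy.1)
    · exact hΦ1.comp e.contDiff.contDiffOn fun y hy => hy.2
  · intro w hw
    have hw' : w ∈ ((A.chart hι).restr O).target := by simpa using hw
    obtain ⟨hwW, hwΦ⟩ := key w hw'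
    have h1 : ι ((A.chart hι).symm w) = Φ (w, 0) := by
      rw [A.apply_chart_symm hι hwW, hΦ, he0, add_zero]
    change e.symm (Φ.symm (ι ((A.chart hι).symm w))) = e.symm (w, 0)
    rw [h1, Φ.left_inv hwΦ]

end Submanifold

end Grassmann

namespace Grassmann

open Set Topology Filter

/-! ### Constructions of local parametrizations. -/

section LocalParamConstructions

variable {E E' F : Type} [NormedAddCommGroup E] [NormedSpace ℝ E] [NormedAddCommGroup E']
  [NormedSpace ℝ E'] [NormedAddCommGroup F] [NormedSpace ℝ F]

/-- A local parametrization by an open subset of a `d`-dimensional vector space. -/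
theorem LocalParam.nonempty_of_finrank [FiniteDimensional ℝ E'] {d : ℕ}
    (hd : Module.finrank ℝ E' = d) {S : Set E} {x : E} {U : Set E} {W : Set E'} {r : E → E'}
    {p : E' → E} (hU : IsOpen U) (hW : IsOpen W) (hx : x ∈ U) (hr : ContDiffOn ℝ ∞ r U)
    (hp : ContDiffOn ℝ ∞ p W) (hrW : ∀ y ∈ U, y ∈ S → r y ∈ W) (hpU : ∀ w ∈ W, p w ∈ U)
    (hpS : ∀ w ∈ W, p w ∈ S) (hrp : ∀ w ∈ W, r (p w) = w) (hpr : ∀ y ∈ U, y ∈ S → p (r y) = y) :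
    Nonempty (LocalParam S d x) := by
  let e : E' ≃L[ℝ] EuclideanSpace ℝ (Fin d) := ContinuousLinearEquiv.ofFinrankEq (by simpa using hd)
  exact ⟨{
    U := U
    W := e.symm ⁻¹' W
    r := e ∘ r
    p := p ∘ e.symm
    isOpen_U := hU
    isOpen_W := hW.preimage e.symm.continuous
    mem_U := hx
    contDiffOn_r := e.contDiff.comp_contDiffOn hr
    contDiffOn_p := hp.comp e.symm.contDiff.contDiffOn fun w hw => hw
    r_mem := fun y hy hyS => by simpa using hrW y hy hyS
    p_mem_U := fun w hw => hpU _ hw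
    p_mem := fun w hw => hpS _ hw
    r_p := fun w hw => by simp [hrp _ hw]
    p_r := fun y hy hyS => by simp [hpr y hy hyS] }⟩

/-- An open set is locally parametrized by the identity. -/
theorem LocalParam.nonempty_of_isOpen [FiniteDimensional ℝ E] {S : Set E} (hS : IsOpen S) {x : E}
    (hx : x ∈ S) {d : ℕ} (hd : Module.finrank ℝ E = d) : Nonempty (LocalParam S d x) :=
  LocalParam.nonempty_of_finrank (r := id) (p := id) hd hS hS hx contDiffOn_id contDiffOn_id
    (fun _ h _ => h) (fun _ h => h) (fun _ h => h) (fun _ _ => rfl) fun _ _ _ => rfl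

/-- The regular level sets of a smooth map have local parametrizations. -/
theorem LocalParam.nonempty_of_levelSet [FiniteDimensional ℝ E] [FiniteDimensional ℝ F] {f : E → F}
    (hf : ContDiff ℝ ∞ f) {x : E} (s : F →L[ℝ] E) (hs : ∀ w, fderiv ℝ f x (s w) = w) {d : ℕ}
    (hd : Module.finrank ℝ E = Module.finrank ℝ F + d) :
    Nonempty (LocalParam {y | f y = 0} d x) := by
  obtain ⟨e, he, -⟩ := exists_splitting (K := EuclideanSpace ℝ (Fin d)) (fderiv ℝ f x) s hs
    (by simpa using hd)
  have hdf : HasFDerivAt f (fderiv ℝ f x) x := (hf.differentiable (by simp) x).hasFDerivAt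
  -- Adjoining linear coordinates complementary to the derivative of `f` makes a local
  -- diffeomorphism that carries the level set to the slice `{0} × ℝ^d`.
  have hG : ContDiff ℝ ∞ fun y => (f y, (e y).2) := hf.prodMk (contDiff_snd.comp e.contDiff)
  have hdG : HasFDerivAt (fun y => (f y, (e y).2)) (e : E →L[ℝ] F × EuclideanSpace ℝ (Fin d)) x := by
    refine (hdf.prodMk ((ContinuousLinearMap.snd ℝ F (EuclideanSpace ℝ (Fin d))).comp
      (e : E →L[ℝ] _)).hasFDerivAt).congr_fderiv ?_
    ext1 y
    exact Prod.ext (he y).symm rfl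
  obtain ⟨Φ, hΦ, hmem, -, -, hΦ2⟩ := exists_smooth_localInverse isOpen_univ hG.contDiffOn
    (mem_univ x) hdG
  have hsymm : ∀ w, ((0 : F), w) ∈ Φ.target →
      f (Φ.symm (0, w)) = 0 ∧ (e (Φ.symm (0, w))).2 = w := by
    intro w hw
    have h := Φ.right_inv hw
    rw [hΦ] at h
    exact ⟨congrArg Prod.fst h, congrArg Prod.snd h⟩
  refine LocalParam.nonempty_of_finrank (E' := EuclideanSpace ℝ (Fin d)) (by simp)
    (U := Φ.source) (W := (fun w => ((0 : F), w)) ⁻¹' Φ.target) (r := fun y => (e y).2)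
    (p := fun w => Φ.symm (0, w)) Φ.open_source (Φ.open_target.preimage (by fun_prop)) hmem
    (contDiff_snd.comp e.contDiff).contDiffOn
    (hΦ2.comp (contDiff_const.prodMk contDiff_id).contDiffOn fun w hw => hw) ?_
    (fun w hw => Φ.map_target hw) (fun w hw => (hsymm w hw).1) (fun w hw => (hsymm w hw).2) ?_
  · intro y hy hyS
    have h := Φ.map_source hy
    rw [hΦ, show f y = 0 from hyS] at h
    exact h
  · intro y hy hyS
    have h := Φ.left_inv hy
    rwa [hΦ, show f y = 0 from hyS] at h

/-- Local parametrizations are transported by a diffeomorphism of the ambient spaces. -/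
theorem LocalParam.nonempty_map {S : Set E} {d : ℕ} {x : E} (P : LocalParam S d x)
    {T : E → E'} {T' : E' → E} (hT : ContDiff ℝ ∞ T) (hT' : ContDiff ℝ ∞ T')
    (hl : ∀ y, T' (T y) = y) (hr : ∀ y, T (T' y) = y) :
    Nonempty (LocalParam (T' ⁻¹' S) d (T x)) :=
  ⟨{ U := T' ⁻¹' P.U
     W := P.W
     r := P.r ∘ T'
     p := T ∘ P.p
     isOpen_U := P.isOpen_U.preimage hT'.continuous
     isOpen_W := P.isOpen_W
     mem_U := by rw [mem_preimage, hl]; exact P.mem_U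
     contDiffOn_r := P.contDiffOn_r.comp hT'.contDiffOn fun y hy => hy
     contDiffOn_p := hT.comp_contDiffOn P.contDiffOn_p
     r_mem := fun y hy hyS => P.r_mem _ hy hyS
     p_mem_U := fun w hw => by simpa [hl] using P.p_mem_U w hw
     p_mem := fun w hw => by simpa [hl] using P.p_mem w hw
     r_p := fun w hw => by simp [hl, P.r_p w hw]
     p_r := fun y hy hyS => by simp [P.p_r _ hy hyS, hr] }⟩

end LocalParamConstructions

/-! ### Submersions and their local sections. -/

section Submersion

variable {M N : Type} [TopologicalSpace M] [TopologicalSpace N] {e d : ℕ}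
  [ChartedSpace (EuclideanSpace ℝ (Fin e)) M] [ChartedSpace (EuclideanSpace ℝ (Fin d)) N]

/-- A submersion has smooth local sections. -/
theorem exists_section_of_isSubmersionAt [IsManifold (𝓡 e) ∞ M] [IsManifold (𝓡 d) ∞ N]
    {π : M → N} {x : M} (h : Manifold.IsSubmersionAt (𝓡 e) (𝓡 d) ∞ π x) :
    ∃ σ : N → M, ContMDiffAt (𝓡 d) (𝓡 e) ∞ σ (π x) ∧ σ (π x) = x ∧
      ∀ᶠ y in 𝓝 (π x), π (σ y) = y := by
  have hw := h.writtenInCharts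
  have hx := h.mem_domChart_source
  have hy := h.mem_codChart_source
  have hD := h.domChart_mem_maximalAtlas
  have hC := h.codChart_mem_maximalAtlas
  have hs := h.source_subset_preimage_source
  set D := h.domChart
  set C := h.codChart
  have hw' : ∀ v ∈ D.target, C (π (D.symm v)) = (h.equiv v).1 := fun v hv =>
    hw (by simpa using hv)
  have hCx : C (π x) = (h.equiv (D x)).1 := by
    rw [← hw' _ (D.map_source hx), D.left_inv hx]
  -- In adapted charts the submersion is a linear projection; the section keeps the fibre coordinate
  -- frozen at its value at `x`.
  let v : N → EuclideanSpace ℝ (Fin e) := fun y => h.equiv.symm (C y, (h.equiv (D x)).2)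
  have hvx : v (π x) = D x := by simp [v, hCx]
  have hCs : ContMDiffAt (𝓡 d) (𝓡 d) ∞ C (π x) :=
    (contMDiffOn_of_mem_maximalAtlas hC).contMDiffAt (C.open_source.mem_nhds hy)
  have hv : ContMDiffAt (𝓡 d) (𝓡 e) ∞ v (π x) := by
    have h1 : ContDiff ℝ ∞ fun w => h.equiv.symm (w, (h.equiv (D x)).2) := by fun_prop
    exact h1.contMDiff.contMDiffAt.comp (π x) hCs
  have hvm : ∀ᶠ y in 𝓝 (π x), v y ∈ D.target := by
    apply hv.continuousAt
    rw [hvx]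
    exact D.open_target.mem_nhds (D.map_source hx)
  refine ⟨fun y => D.symm (v y), ?_, by simp only [hvx, D.left_inv hx], ?_⟩
  · have h1 : ContMDiffAt (𝓡 e) (𝓡 e) ∞ D.symm (v (π x)) :=
      (contMDiffOn_symm_of_mem_maximalAtlas hD).contMDiffAt (D.open_target.mem_nhds
        (by rw [hvx]; exact D.map_source hx))
    exact h1.comp (π x) hv
  · filter_upwards [hvm, C.open_source.mem_nhds hy] with y h1 h2
    apply C.injOn (hs (D.map_target h1)) h2
    rw [hw' _ h1]
    simp [v]

/-- This allows the domain chart of a submersion to be corrected by a local diffeomorphism of the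
model space. -/
theorem trans_mem_maximalAtlas {H X : Type*} [TopologicalSpace H] [TopologicalSpace X]
    [ChartedSpace H X] {G : StructureGroupoid H} [HasGroupoid X G] {φ : OpenPartialHomeomorph X H}
    (hφ : φ ∈ G.maximalAtlas X) {Θ : OpenPartialHomeomorph H H} (hΘ : Θ ∈ G) :
    φ.trans Θ ∈ G.maximalAtlas X := by
  rw [mem_maximalAtlas_iff]
  intro e' he'
  have he := G.subset_maximalAtlas he'
  constructor
  · rw [OpenPartialHomeomorph.trans_symm_eq_symm_trans_symm, OpenPartialHomeomorph.trans_assoc]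
    exact G.trans (G.symm hΘ) (G.compatible_of_mem_maximalAtlas hφ he)
  · rw [← OpenPartialHomeomorph.trans_assoc]
    exact G.trans (G.compatible_of_mem_maximalAtlas he hφ) hΘ

/-- A smooth map which has differentiable local sections is a submersion. -/
theorem isSubmersion_of_sections [IsManifold (𝓡 e) ∞ M] [IsManifold (𝓡 d) ∞ N]
    {π : M → N} (hπ : ContMDiff (𝓡 e) (𝓡 d) ∞ π)
    (hsec : ∀ x, ∃ σ : N → M, MDifferentiableAt (𝓡 d) (𝓡 e) σ (π x) ∧ σ (π x) = x ∧
      ∀ᶠ y in 𝓝 (π x), π (σ y) = y) : Manifold.IsSubmersion (𝓡 e) (𝓡 d) ∞ π := by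
  refine ⟨EuclideanSpace ℝ (Fin (e - d)), inferInstance, inferInstance, fun x => ?_⟩
  obtain ⟨σ, hσ, hσx, hσπ⟩ := hsec x
  set φ := chartAt (EuclideanSpace ℝ (Fin e)) x
  set ψ := chartAt (EuclideanSpace ℝ (Fin d)) (π x)
  have hx : x ∈ φ.source := mem_chart_source _ x
  have hy : π x ∈ ψ.source := mem_chart_source _ (π x)
  set f : EuclideanSpace ℝ (Fin e) → EuclideanSpace ℝ (Fin d) := fun u => ψ (π (φ.symm u))
  set g : EuclideanSpace ℝ (Fin d) → EuclideanSpace ℝ (Fin e) := fun w => φ (σ (ψ.symm w))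
  set U := φ.target ∩ φ.symm ⁻¹' (π ⁻¹' ψ.source)
  have hU : IsOpen U :=
    φ.symm.continuousOn.isOpen_inter_preimage φ.open_target (ψ.open_source.preimage hπ.continuous)
  have hxU : φ x ∈ U := ⟨φ.map_source hx, by simpa [φ.left_inv hx] using hy⟩
  have hf : ContDiffOn ℝ ∞ f U := by
    have := (contMDiff_iff.1 hπ).2 x (π x)
    simpa [f, U, Function.comp_def] using this
  have hg : DifferentiableAt ℝ g (ψ (π x)) := by
    have := ((mdifferentiableAt_iff _ _).1 hσ).2
    rw [writtenInExtChartAt, hσx] at this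
    simp only [mfld_simps, differentiableWithinAt_univ] at this
    exact this
  have hgx : g (ψ (π x)) = φ x := by simp only [g, ψ.left_inv hy, hσx]
  have hfg : HasFDerivAt (f ∘ g) (ContinuousLinearMap.id ℝ _) (ψ (π x)) := by
    refine (hasFDerivAt_id _).congr_of_eventuallyEq ?_
    have h1 : Tendsto ψ.symm (𝓝 (ψ (π x))) (𝓝 (π x)) := ψ.tendsto_symm hy
    have h2 : ∀ᶠ y in 𝓝 (π x), σ y ∈ φ.source := by
      apply hσ.continuousAt
      rw [hσx]
      exact φ.open_source.mem_nhds hx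
    filter_upwards [h1.eventually hσπ, h1.eventually h2,
      ψ.open_target.mem_nhds (ψ.map_source hy)] with w h3 h4 h5
    simp [f, g, φ.left_inv h4, h3, ψ.right_inv h5]
  have hdf : HasFDerivAt f (fderiv ℝ f (φ x)) (g (ψ (π x))) := by
    rw [hgx]
    exact ((hf.contDiffAt (hU.mem_nhds hxU)).differentiableAt (by simp)).hasFDerivAt
  -- Differentiating `f ∘ g = id` in charts shows that the derivative of the section splits that of
  -- `π`.
  have hqs : ∀ w, fderiv ℝ f (φ x) (fderiv ℝ g (ψ (π x)) w) = w :=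
    fun w => DFunLike.congr_fun ((hdf.comp _ hg.hasFDerivAt).unique hfg) w
  have hle : d ≤ e := by
    have := LinearMap.finrank_le_finrank_of_injective
      (f := (fderiv ℝ g (ψ (π x)) : EuclideanSpace ℝ (Fin d) →ₗ[ℝ] EuclideanSpace ℝ (Fin e)))
      (Function.LeftInverse.injective hqs)
    simpa using this
  obtain ⟨ε, hε, -⟩ := exists_splitting (K := EuclideanSpace ℝ (Fin (e - d))) _ _ hqs
    (by simp; omega)
  rw [hgx] at hdf
  have hG : ContDiffOn ℝ ∞ (fun u => (f u, (ε u).2)) U :=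
    hf.prodMk (contDiff_snd.comp ε.contDiff).contDiffOn
  have hdG : HasFDerivAt (fun u => (f u, (ε u).2)) (ε : _ →L[ℝ] EuclideanSpace ℝ (Fin d) ×
      EuclideanSpace ℝ (Fin (e - d))) (φ x) := by
    refine (hdf.prodMk ((ContinuousLinearMap.snd ℝ (EuclideanSpace ℝ (Fin d)) (EuclideanSpace ℝ (Fin (e - d)))).comp
      ε.toContinuousLinearMap).hasFDerivAt).congr_fderiv ?_
    ext1 y
    exact Prod.ext (hε y).symm rfl
  obtain ⟨Φ, hΦ, hmem, -, hΦ1, hΦ2⟩ := exists_smooth_localInverse hU hG hxU hdG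
  -- After this change of the domain chart, `π` reads as the first component of `ε`, which is the
  -- normal form of a submersion.
  let Θ := Φ.trans ε.symm.toHomeomorph.toOpenPartialHomeomorph
  have hΘ : Θ ∈ contDiffGroupoid ∞ (𝓡 e) := by
    apply mem_contDiffGroupoid_of_contDiffOn
    · exact ε.symm.contDiff.comp_contDiffOn (hΦ1.mono fun y hy => hy.1)
    · exact hΦ2.comp ε.contDiff.contDiffOn fun y hy => hy.2
  refine Manifold.IsSubmersionAtOfComplement.mk_of_continuousAt hπ.continuous.continuousAt
    ε (φ.trans Θ) ψ ⟨hx, hmem, mem_univ _⟩ hy ?_ (IsManifold.chart_mem_maximalAtlas _) ?_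
  · exact trans_mem_maximalAtlas (IsManifold.chart_mem_maximalAtlas x) hΘ
  · intro v hv
    have hv' : v ∈ (φ.trans Θ).target := by simpa using hv
    have h1 : ε v ∈ Φ.target := hv'.1.2
    have h2 := congrArg Prod.fst (Φ.right_inv h1)
    rw [hΦ] at h2
    exact h2

end Submersion

end Grassmann

namespace Grassmann

open Set Topology Filter

/-! ### Quotients with the same fibres as a map to a submanifold. -/

section Quotient

variable {E E₁ : Type} [NormedAddCommGroup E] [NormedSpace ℝ E] [NormedAddCommGroup E₁]
  [NormedSpace ℝ E₁] {M N X : Type} [TopologicalSpace M] [TopologicalSpace N] [TopologicalSpace X]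
  {ι : M → E} {ι₁ : X → E₁} {π : M → N} {Ψ : M → X} {e d : ℕ}

/-- A map between submanifolds which extends to a smooth map near a point is smooth there. -/
theorem contMDiffAt_of_ambient [cM : ChartedSpace (EuclideanSpace ℝ (Fin e)) M]
    [cX : ChartedSpace (EuclideanSpace ℝ (Fin d)) X] (hM : IsSubmanifoldStructure e ι cM)
    (hX : IsSubmanifoldStructure d ι₁ cX) {f : M → X} {g : E → E₁} {x : M}
    (hg : ContDiffAt ℝ ∞ g (ι x)) (hgf : ∀ᶠ y in 𝓝 x, ι₁ (f y) = g (ι y)) :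
    ContMDiffAt (𝓡 e) (𝓡 d) ∞ f x := by
  have := hM.isManifold
  have := hX.isManifold
  have h1 : ContMDiffAt (𝓡 e) 𝓘(ℝ, E₁) ∞ (ι₁ ∘ f) x :=
    (hg.contMDiffAt.comp x (hM.isSmoothEmbedding.contMDiff x)).congr_of_eventuallyEq hgf
  -- Smoothness into `X` may be tested after the immersion `ι₁` once continuity is known, and
  -- continuity holds because `ι₁` is a topological embedding.
  rw [ContMDiffAt.iff_comp_isImmersionAt (hX.isSmoothEmbedding.isImmersion.isImmersionAt (f x))]
  exact ⟨hX.isSmoothEmbedding.isEmbedding.isInducing.continuousAt_iff.2 h1.continuousAt, h1⟩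

/-- The maps `π : M → N` and `Ψ : M → X`, where `M ⊆ E` and `X ⊆ E₁`, have the same fibres, `π` is a
topological quotient map, and `Ψ` is a surjection which, as do local sections of it, extends to
smooth maps on open subsets of `E` and `E₁`. -/
structure IsQuotientModel (ι : M → E) (ι₁ : X → E₁) (π : M → N) (Ψ : M → X) : Prop where
  isQuotientMap : IsQuotientMap π
  fiber : ∀ x y, π x = π y ↔ Ψ x = Ψ y
  surjective : Function.Surjective Ψ
  smooth : ∀ x, ∃ f : E → E₁, ContDiffAt ℝ ∞ f (ι x) ∧ ∀ y, ι₁ (Ψ y) = f (ι y)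
  exists_section : ∀ x, ∃ (σ : X → M) (s : E₁ → E), ContDiffAt ℝ ∞ s (ι₁ (Ψ x)) ∧ σ (Ψ x) = x ∧
    (∀ᶠ Q in 𝓝 (Ψ x), Ψ (σ Q) = Q) ∧ ∀ᶠ Q in 𝓝 (Ψ x), ι (σ Q) = s (ι₁ Q)

namespace IsQuotientModel

theorem exists_equiv (h : IsQuotientModel ι ι₁ π Ψ) : ∃ φ : N ≃ X, ∀ x, φ (π x) = Ψ x := by
  choose ρ hρ using h.isQuotientMap.surjective
  refine ⟨Equiv.ofBijective (fun y => Ψ (ρ y)) ⟨fun y z hyz => ?_, fun Q => ?_⟩, fun x => ?_⟩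
  · rw [← hρ y, ← hρ z]
    exact (h.fiber _ _).2 hyz
  · obtain ⟨x, rfl⟩ := h.surjective Q
    exact ⟨π x, (h.fiber _ _).1 (hρ _)⟩
  · exact (h.fiber _ _).1 (hρ _)

/-- Continuity of `φ` descends through the quotient map from that of `Ψ`. The inverse is locally `π
∘ σ`, with `σ` continuous because its ambient expression `s` is. -/
theorem exists_homeomorph (h : IsQuotientModel ι ι₁ π Ψ) (hι : IsEmbedding ι)
    (hι₁ : IsEmbedding ι₁) : ∃ φ : N ≃ₜ X, ∀ x, φ (π x) = Ψ x := by
  obtain ⟨φ, hφ⟩ := h.exists_equiv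
  refine ⟨⟨φ, ?_, ?_⟩, hφ⟩
  · rw [h.isQuotientMap.continuous_iff, hι₁.isInducing.continuous_iff, continuous_iff_continuousAt]
    intro x
    obtain ⟨f, hf, hf'⟩ := h.smooth x
    refine (hf.continuousAt.comp (f := ι) hι.continuous.continuousAt).congr ?_
    exact Eventually.of_forall fun y => by simp [hφ, hf']
  · rw [continuous_iff_continuousAt]
    intro Q
    obtain ⟨x, rfl⟩ := h.surjective Q
    obtain ⟨σ, s, hs, hσx, hσ, hσs⟩ := h.exists_section x
    have h1 : ContinuousAt σ (Ψ x) := by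
      rw [hι.isInducing.continuousAt_iff]
      exact (hs.continuousAt.comp (f := ι₁) hι₁.continuous.continuousAt).congr
        (hσs.mono fun y hy => hy.symm)
    refine (h.isQuotientMap.continuous.continuousAt.comp h1).congr ?_
    filter_upwards [hσ] with Q hQ
    change π (σ Q) = φ.symm Q
    rw [Equiv.eq_symm_apply, hφ, hQ]

/-- The quotient has a smooth structure for which the quotient map is a submersion. -/
theorem exists_isQuotientStructure [FiniteDimensional ℝ E₁] (h : IsQuotientModel ι ι₁ π Ψ)
    (hι₁ : IsEmbedding ι₁) (P : ∀ Q : X, LocalParam (range ι₁) d (ι₁ Q))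
    [cM : ChartedSpace (EuclideanSpace ℝ (Fin e)) M] (hM : IsSubmanifoldStructure e ι cM) :
    ∃ c, IsQuotientStructure d π cM c := by
  obtain ⟨φ, hφ⟩ := h.exists_homeomorph hM.isSmoothEmbedding.isEmbedding hι₁
  have hrange : range (ι₁ ∘ φ) = range ι₁ := φ.surjective.range_comp ι₁
  -- The embedding `ι₁ ∘ φ` turns `N` into a submanifold of `E₁`, so the smoothness of `π` and of
  -- its sections reduces to that of the ambient maps `f` and `s`.
  obtain ⟨c, hc⟩ := exists_isSubmanifoldStructure (ι := ι₁ ∘ φ) (hι₁.comp φ.isEmbedding)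
    fun y => hrange ▸ P (φ y)
  have := hM.isManifold
  have := hc.isManifold
  refine ⟨c, hc.isManifold, isSubmersion_of_sections (fun x => ?_) fun x => ?_⟩
  · obtain ⟨f, hf, hf'⟩ := h.smooth x
    exact contMDiffAt_of_ambient hM hc hf (Eventually.of_forall fun y => by simp [hφ, hf'])
  · obtain ⟨σ, s, hs, hσx, hσ, hσs⟩ := h.exists_section x
    have hφx : Tendsto φ (𝓝 (π x)) (𝓝 (Ψ x)) := hφ x ▸ φ.continuous.continuousAt
    refine ⟨σ ∘ φ, ContMDiffAt.mdifferentiableAt (n := ∞) ?_ (by simp), ?_, ?_⟩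
    · exact contMDiffAt_of_ambient hc hM (g := s) (by simpa [hφ] using hs) (hφx.eventually hσs)
    · simp [hφ, hσx]
    · filter_upwards [hφx.eventually hσ] with y hy
      apply φ.injective
      rw [hφ]
      exact hy

/-- Any two quotient manifold and submanifold structures on `N` and `X` are diffeomorphic. -/
theorem exists_diffeomorph (h : IsQuotientModel ι ι₁ π Ψ)
    [cM : ChartedSpace (EuclideanSpace ℝ (Fin e)) M] (hM : IsSubmanifoldStructure e ι cM)
    [cX : ChartedSpace (EuclideanSpace ℝ (Fin d)) X] (hX : IsSubmanifoldStructure d ι₁ cX)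
    [c : ChartedSpace (EuclideanSpace ℝ (Fin d)) N] (hc : IsQuotientStructure d π cM c) :
    ∃ φ : N ≃ₘ^∞⟮𝓡 d, 𝓡 d⟯ X, ∀ x, φ (π x) = Ψ x := by
  obtain ⟨φ, hφ⟩ := h.exists_equiv
  have := hM.isManifold
  have := hX.isManifold
  have := hc.isManifold
  refine ⟨⟨φ, fun y => ?_, fun Q => ?_⟩, hφ⟩
  · obtain ⟨x, rfl⟩ := h.isQuotientMap.surjective y
    obtain ⟨f, hf, hf'⟩ := h.smooth x
    have h1 : ContMDiffAt (𝓡 e) (𝓡 d) ∞ Ψ x :=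
      contMDiffAt_of_ambient hM hX hf (Eventually.of_forall hf')
    -- Only the submersion property of the given structure on `N` is available here; it provides the
    -- section through which `φ` becomes `Ψ ∘ σ`.
    obtain ⟨σ, hσ, hσx, hσπ⟩ := exists_section_of_isSubmersionAt (hc.isSubmersion.isSubmersionAt x)
    refine ContMDiffAt.congr_of_eventuallyEq (f := Ψ ∘ σ) ?_ ?_
    · exact ContMDiffAt.comp (π x) (hσx.symm ▸ h1) hσ
    · filter_upwards [hσπ] with y hy
      change φ y = Ψ (σ y)
      rw [← hφ, hy]
  · obtain ⟨x, rfl⟩ := h.surjective Q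
    obtain ⟨σ, s, hs, hσx, hσ, hσs⟩ := h.exists_section x
    have h1 : ContMDiffAt (𝓡 d) (𝓡 e) ∞ σ (Ψ x) := contMDiffAt_of_ambient hX hM hs hσs
    refine ContMDiffAt.congr_of_eventuallyEq (f := π ∘ σ) ?_ ?_
    · exact (hc.isSubmersion.contMDiff _).comp _ h1
    · filter_upwards [hσ] with Q hQ
      change φ.symm Q = π (σ Q)
      rw [Equiv.symm_apply_eq, hφ, hQ]

end IsQuotientModel

end Quotient

end Grassmann

namespace Grassmann

open Set Topology Filter

-- The entrywise sup norm agrees definitionally with the norm of `Fin n → Fin k → ℝ` used for the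
-- smooth structures, so matrix statements apply to arrays of entries directly.
attribute [local instance] Matrix.normedAddCommGroup Matrix.normedSpace

/-! ### Smoothness of the matrix operations. -/

section MatrixCalculus

variable {l m n : Type} [Fintype l] [Fintype m] [Fintype n]
  {G : Type*} [NormedAddCommGroup G] [NormedSpace ℝ G]

/-- Matrix multiplication, as a continuous bilinear map. -/
noncomputable def mulBilin (l m n : Type) [Fintype l] [Fintype m] [Fintype n] :
    Matrix l m ℝ →L[ℝ] Matrix m n ℝ →L[ℝ] Matrix l n ℝ :=
  (LinearMap.mk₂ ℝ (fun (A : Matrix l m ℝ) (B : Matrix m n ℝ) => A * B) Matrix.add_mul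
    Matrix.smul_mul Matrix.mul_add fun c A B => Matrix.mul_smul A c B).toContinuousBilinearMap

theorem mulBilin_apply (A : Matrix l m ℝ) (B : Matrix m n ℝ) : mulBilin l m n A B = A * B := rfl

theorem _root_.ContDiffAt.matrix_mul {f : G → Matrix l m ℝ} {g : G → Matrix m n ℝ} {x : G}
    (hf : ContDiffAt ℝ ∞ f x) (hg : ContDiffAt ℝ ∞ g x) : ContDiffAt ℝ ∞ (fun y => f y * g y) x :=
  (mulBilin l m n).isBoundedBilinearMap.contDiff.contDiffAt.comp x (hf.prodMk hg)

theorem _root_.ContDiffAt.matrix_transpose {f : G → Matrix l m ℝ} {x : G}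
    (hf : ContDiffAt ℝ ∞ f x) : ContDiffAt ℝ ∞ (fun y => (f y)ᵀ) x :=
  ((Matrix.transposeLinearEquiv l m ℝ ℝ).toContinuousLinearEquiv.contDiff).contDiffAt.comp x hf

theorem contDiff_matrix_entry (i : l) (j : m) : ContDiff ℝ ∞ fun A : Matrix l m ℝ => A i j :=
  ((Matrix.entryLinearMap ℝ ℝ i j).toContinuousLinearMap).contDiff

theorem contDiff_matrix_of_entry {f : G → Matrix l m ℝ}
    (hf : ∀ i j, ContDiff ℝ ∞ fun x => f x i j) : ContDiff ℝ ∞ f :=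
  contDiff_pi.2 fun i => contDiff_pi.2 fun j => hf i j

theorem contDiff_matrix_det [DecidableEq n] : ContDiff ℝ ∞ fun A : Matrix n n ℝ => A.det := by
  simp only [Matrix.det_apply']
  exact ContDiff.sum fun σ _ => contDiff_const.mul
    (contDiff_prod fun i _ => contDiff_matrix_entry (σ i) i)

theorem contDiff_matrix_adjugate [DecidableEq n] :
    ContDiff ℝ ∞ fun A : Matrix n n ℝ => A.adjugate := by
  refine contDiff_matrix_of_entry fun i j => ?_
  simp only [Matrix.adjugate_apply]
  refine contDiff_matrix_det.comp (contDiff_matrix_of_entry fun a b => ?_)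
  by_cases h : a = j
  · subst h
    simp only [Matrix.updateRow_self]
    exact contDiff_const
  · simp only [Matrix.updateRow_ne h]
    exact contDiff_matrix_entry a b

/-- By Cramer's rule the inverse is the adjugate, which is polynomial in the entries, divided by the
determinant. -/
theorem _root_.ContDiffAt.matrix_inv [DecidableEq n] {f : G → Matrix n n ℝ} {x : G}
    (hf : ContDiffAt ℝ ∞ f x) (h : (f x).det ≠ 0) : ContDiffAt ℝ ∞ (fun y => (f y)⁻¹) x := by
  simp only [Matrix.inv_def, Ring.inverse_eq_inv']
  exact ((contDiff_matrix_det.contDiffAt.comp x hf).inv h).smul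
    (contDiff_matrix_adjugate.contDiffAt.comp x hf)

end MatrixCalculus

/-! ### Square roots near the identity and conjugation of involutions. -/

section LocalSection

variable {n : Type} [Fintype n] [DecidableEq n]

/-- A smooth square root of matrices near the identity. -/
theorem exists_local_sqrt (n : Type) [Fintype n] [DecidableEq n] :
    ∃ g : Matrix n n ℝ → Matrix n n ℝ, ContDiffAt ℝ ∞ g 1 ∧ g 1 = 1 ∧
      (∀ᶠ A in 𝓝 1, g A * g A = A) ∧ ∀ᶠ S in 𝓝 1, g (S * S) = S := by
  have hf : ContDiff ℝ ∞ fun S : Matrix n n ℝ => S * S :=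
    contDiff_iff_contDiffAt.2 fun S => contDiffAt_id.matrix_mul contDiffAt_id
  -- The derivative of squaring at `1` is multiplication by `2`, so squaring is locally invertible
  -- there; the left inverse property gives uniqueness of square roots near `1`.
  let e : Matrix n n ℝ ≃L[ℝ] Matrix n n ℝ :=
    (LinearEquiv.smulOfNeZero ℝ (Matrix n n ℝ) (2 : ℝ) two_ne_zero).toContinuousLinearEquiv
  have hd : HasFDerivAt (fun S : Matrix n n ℝ => S * S) (e : Matrix n n ℝ →L[ℝ] Matrix n n ℝ) 1 := by
    have h := (mulBilin n n n).hasFDerivAt_of_bilinear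
      (hasFDerivAt_id (𝕜 := ℝ) (1 : Matrix n n ℝ)) (hasFDerivAt_id (𝕜 := ℝ) (1 : Matrix n n ℝ))
    refine h.congr_fderiv ?_
    ext1 S
    change mulBilin n n n 1 S + mulBilin n n n S 1 = (2 : ℝ) • S
    rw [mulBilin_apply, mulBilin_apply, one_mul, mul_one, two_smul]
  obtain ⟨Φ, hΦ, hmem, -, -, hΦ2⟩ := exists_smooth_localInverse isOpen_univ hf.contDiffOn
    (mem_univ _) hd
  have hΦ1 : Φ 1 = 1 := by rw [hΦ, one_mul]
  have h1 : (1 : Matrix n n ℝ) ∈ Φ.target := hΦ1 ▸ Φ.map_source hmem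
  refine ⟨Φ.symm, hΦ2.contDiffAt (Φ.open_target.mem_nhds h1), ?_, ?_, ?_⟩
  · nth_rw 1 [← hΦ1]
    exact Φ.left_inv hmem
  · filter_upwards [Φ.open_target.mem_nhds h1] with A hA
    rw [← hΦ, Φ.right_inv hA]
  · filter_upwards [Φ.open_source.mem_nhds hmem] with S hS
    rw [← hΦ, Φ.left_inv hS]

/-- Symmetric involutions near `Q₀` are conjugate to `Q₀` by an orthogonal matrix which depends
smoothly on the involution. -/
theorem exists_local_conj {Q₀ : Matrix n n ℝ} (hT : Q₀ᵀ = Q₀) (hsq : Q₀ * Q₀ = 1) :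
    ∃ U : Matrix n n ℝ → Matrix n n ℝ, ContDiffAt ℝ ∞ U Q₀ ∧ U Q₀ = 1 ∧
      ∀ᶠ Q in 𝓝 Q₀, Qᵀ = Q → Q * Q = 1 → U Q * (U Q)ᵀ = 1 ∧ U Q * Q₀ * (U Q)ᵀ = Q := by
  obtain ⟨g, hg, hg1, hgsq, hsqg⟩ := exists_local_sqrt n
  have hU : ContDiffAt ℝ ∞ (fun Q => g (Q * Q₀)) Q₀ := by
    refine ContDiffAt.comp Q₀ (by rwa [hsq]) (contDiffAt_id.matrix_mul contDiffAt_const)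
  have hc : ContinuousAt (fun Q => g (Q * Q₀)) Q₀ := hU.continuousAt
  have hU1 : g (Q₀ * Q₀) = 1 := by rw [hsq, hg1]
  refine ⟨_, hU, hU1, ?_⟩
  -- The matrices `uᵀ`, `Q₀ u Q₀` and `u Q₀ Q`, where `u = g (Q Q₀)`, all tend to `1` as `Q` tends
  -- to `Q₀` and all square to `Q₀ Q`. By uniqueness of the root they coincide, so `u uᵀ = u² Q₀ Q =
  -- 1` and `u Q₀ uᵀ = u² Q₀ = Q`.
  have e0 : Tendsto (fun Q : Matrix n n ℝ => Q * Q₀) (𝓝 Q₀) (𝓝 1) := by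
    have : ContinuousAt (fun Q : Matrix n n ℝ => Q * Q₀) Q₀ := by fun_prop
    simpa [ContinuousAt, hsq] using this
  have e1 : Tendsto (fun Q => (g (Q * Q₀))ᵀ) (𝓝 Q₀) (𝓝 1) := by
    have : ContinuousAt (fun Q => (g (Q * Q₀))ᵀ) Q₀ := hU.matrix_transpose.continuousAt
    simpa [ContinuousAt, hU1] using this
  have e2 : Tendsto (fun Q => Q₀ * g (Q * Q₀) * Q₀) (𝓝 Q₀) (𝓝 1) := by
    have : ContinuousAt (fun Q => Q₀ * g (Q * Q₀) * Q₀) Q₀ :=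
      ((contDiffAt_const.matrix_mul hU).matrix_mul contDiffAt_const).continuousAt
    simpa [ContinuousAt, hg1, hsq] using this
  have e3 : Tendsto (fun Q => g (Q * Q₀) * (Q₀ * Q)) (𝓝 Q₀) (𝓝 1) := by
    have : ContinuousAt (fun Q => g (Q * Q₀) * (Q₀ * Q)) Q₀ :=
      (hU.matrix_mul (contDiffAt_const.matrix_mul contDiffAt_id)).continuousAt
    simpa [ContinuousAt, hg1, hsq] using this
  filter_upwards [e0.eventually hgsq, e1.eventually hsqg, e2.eventually hsqg,
    e3.eventually hsqg] with Q h0 h1 h2 h3 hQT hQ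
  set u := g (Q * Q₀)
  have hsq' : ∀ A, Q₀ * (Q₀ * A) = A := fun A => by rw [← mul_assoc, hsq, one_mul]
  have hQ' : ∀ A, Q * (Q * A) = A := fun A => by rw [← mul_assoc, hQ, one_mul]
  have h0' : ∀ A, u * (u * A) = Q * (Q₀ * A) := fun A => by rw [← mul_assoc, h0, mul_assoc]
  have c1 : u * (Q * Q₀) = Q * Q₀ * u := by rw [← h0, mul_assoc]
  -- `Q₀ Q` is the inverse of `Q Q₀ = u²`, so it commutes with `u` as well.
  have c2 : Q₀ * Q * u = u * (Q₀ * Q) := by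
    calc Q₀ * Q * u = Q₀ * Q * (u * (Q * Q₀)) * (Q₀ * Q) := by
          simp only [mul_assoc, hsq', hQ, mul_one]
      _ = u * (Q₀ * Q) := by rw [c1]; simp only [mul_assoc, hsq', hQ']
  have s1 : uᵀ * uᵀ = Q₀ * Q := by
    rw [← Matrix.transpose_mul, h0, Matrix.transpose_mul, hT, hQT]
  have s2 : Q₀ * u * Q₀ * (Q₀ * u * Q₀) = Q₀ * Q := by
    simp only [mul_assoc, hsq', h0', hsq, mul_one]
  have s3 : u * (Q₀ * Q) * (u * (Q₀ * Q)) = Q₀ * Q := by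
    calc u * (Q₀ * Q) * (u * (Q₀ * Q)) = u * (Q₀ * Q * u) * (Q₀ * Q) := by
          simp only [mul_assoc]
      _ = Q₀ * Q := by rw [c2]; simp only [mul_assoc, h0', hsq', hQ']
  rw [s1] at h1
  rw [s2, h1] at h2
  rw [s3, h1] at h3
  constructor
  · rw [h3]
    simp only [h0', hsq', hQ]
  · rw [h2]
    simp only [mul_assoc, hsq', h0', hsq, mul_one]

end LocalSection

end Grassmann

namespace Grassmann

open Set Topology Filter

attribute [local instance] Matrix.normedAddCommGroup Matrix.normedSpace

/-! ### Orthogonal projections and their graph charts. -/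

section Projections

variable {m n l : Type} [Fintype m] [Fintype n] [Fintype l] [DecidableEq m]

/-- An orthogonal projection is determined by a subspace of its range and its trace. -/
theorem projection_eq_of_mul_eq {P R : Matrix n n ℝ} (hP : Pᵀ = P) (hP' : P * P = P) (hR : Rᵀ = R)
    (hR' : R * R = R) (hPR : P * R = R) (htr : P.trace = R.trace) : P = R := by
  have hRP : R * P = R := by
    have := congrArg Matrix.transpose hPR
    rwa [Matrix.transpose_mul, hP, hR] at this
  -- The difference is again an orthogonal projection, so its squared Frobenius norm equals its
  -- trace, which vanishes.
  have h : (P - R)ᴴ * (P - R) = P - R := by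
    rw [Matrix.conjTranspose_eq_transpose_of_trivial, Matrix.transpose_sub, hP, hR, sub_mul, mul_sub,
      mul_sub, hP', hR', hPR, hRP]
    abel
  rw [← sub_eq_zero, ← Matrix.trace_conjTranspose_mul_self_eq_zero_iff, h, Matrix.trace_sub, htr,
    sub_self]

/-- The orthogonal projection onto the column space of a matrix of full column rank. -/
noncomputable def colProj (A : Matrix n m ℝ) : Matrix n n ℝ := A * (Aᵀ * A)⁻¹ * Aᵀ

theorem colProj_transpose (A : Matrix n m ℝ) : (colProj A)ᵀ = colProj A := by
  simp [colProj, Matrix.transpose_nonsing_inv, Matrix.mul_assoc]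

theorem colProj_mul_self {A : Matrix n m ℝ} (hA : (Aᵀ * A).det ≠ 0) : colProj A * A = A := by
  rw [colProj, Matrix.mul_assoc, Matrix.mul_assoc, Matrix.nonsing_inv_mul _ hA.isUnit,
    Matrix.mul_one]

theorem colProj_mul_colProj {A : Matrix n m ℝ} (hA : (Aᵀ * A).det ≠ 0) :
    colProj A * colProj A = colProj A := by
  nth_rw 2 [colProj]
  rw [← Matrix.mul_assoc, ← Matrix.mul_assoc, colProj_mul_self hA, colProj]

theorem trace_colProj {A : Matrix n m ℝ} (hA : (Aᵀ * A).det ≠ 0) :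
    (colProj A).trace = Fintype.card m := by
  rw [colProj, Matrix.mul_assoc, Matrix.trace_mul_comm, Matrix.mul_assoc,
    Matrix.nonsing_inv_mul _ hA.isUnit, Matrix.trace_one]

theorem det_transpose_mul_self_ne_zero_iff {k : ℕ} {A : Matrix n (Fin k) ℝ} :
    (Aᵀ * A).det ≠ 0 ↔ A.rank = k := by
  rw [← Matrix.rank_transpose_mul_self, ← isUnit_iff_ne_zero, ← Matrix.isUnit_iff_isUnit_det]
  constructor
  · intro h
    rw [Matrix.rank_of_isUnit _ h, Fintype.card_fin]
  · intro h
    rw [← Matrix.mulVec_surjective_iff_isUnit, ← Matrix.coe_mulVecLin, ← LinearMap.range_eq_top]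
    apply Submodule.eq_top_of_finrank_eq
    rw [← Matrix.rank, h]
    simp

theorem contDiffAt_colProj {A : Matrix n m ℝ} (hA : (Aᵀ * A).det ≠ 0) :
    ContDiffAt ℝ ∞ (colProj : Matrix n m ℝ → Matrix n n ℝ) A :=
  (contDiffAt_id.matrix_mul ((contDiffAt_id.matrix_transpose.matrix_mul contDiffAt_id).matrix_inv
    hA)).matrix_mul contDiffAt_id.matrix_transpose

theorem det_one_add_transpose_mul_self_ne_zero (B : Matrix l m ℝ) : (1 + Bᵀ * B).det ≠ 0 := by
  have h : (1 + Bᴴ * B).PosDef :=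
    Matrix.PosDef.one.add_posSemidef (Matrix.posSemidef_conjTranspose_mul_self B)
  rw [Matrix.conjTranspose_eq_transpose_of_trivial] at h
  exact h.det_pos.ne'

theorem isOpen_det_ne_zero {X : Type*} [TopologicalSpace X] {f : X → Matrix m m ℝ}
    (hf : Continuous f) : IsOpen {x | (f x).det ≠ 0} :=
  isOpen_ne_fun hf.matrix_det continuous_const

/-- Orthogonal projections are locally graphs over the range of a given one. -/
theorem nonempty_localParam_projection [DecidableEq n] [DecidableEq l] {Y : Matrix n m ℝ}
    {Z : Matrix n l ℝ} (hY : Yᵀ * Y = 1) (hZ : Zᵀ * Z = 1) (hYZ : Yᵀ * Z = 0) (hsum : Y * Yᵀ + Z * Zᵀ = 1) {c : ℝ}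
    (hc : c = Fintype.card m) {d : ℕ} (hd : Fintype.card m * Fintype.card l = d) :
    Nonempty (LocalParam {P : Matrix n n ℝ | Pᵀ = P ∧ P * P = P ∧ P.trace = c} d (Y * Yᵀ)) := by
  have hZY : Zᵀ * Y = 0 := by
    have := congrArg Matrix.transpose hYZ
    simpa using this
  have hV : ∀ B : Matrix l m ℝ, (Y + Z * B)ᵀ * (Y + Z * B) = 1 + Bᵀ * B := by
    intro B
    have h1 : Bᵀ * Zᵀ * (Z * B) = Bᵀ * (Zᵀ * Z) * B := by simp only [Matrix.mul_assoc]
    rw [Matrix.transpose_add, Matrix.transpose_mul, Matrix.add_mul, Matrix.mul_add, Matrix.mul_add,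
      hY, h1, hZ, ← Matrix.mul_assoc, hYZ, Matrix.mul_assoc Bᵀ, hZY]
    simp
  have hVdet : ∀ B : Matrix l m ℝ, ((Y + Z * B)ᵀ * (Y + Z * B)).det ≠ 0 := fun B => by
    rw [hV]
    exact det_one_add_transpose_mul_self_ne_zero B
  have hYV : ∀ B : Matrix l m ℝ, Yᵀ * (Y + Z * B) = 1 := fun B => by
    rw [Matrix.mul_add, hY, ← Matrix.mul_assoc, hYZ, Matrix.zero_mul, add_zero]
  have hZV : ∀ B : Matrix l m ℝ, Zᵀ * (Y + Z * B) = B := fun B => by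
    rw [Matrix.mul_add, hZY, ← Matrix.mul_assoc, hZ, Matrix.one_mul, zero_add]
  have hVY : ∀ B : Matrix l m ℝ, (Y + Z * B)ᵀ * Y = 1 := fun B => by
    have := congrArg Matrix.transpose (hYV B)
    simpa using this
  have hYP : ∀ B : Matrix l m ℝ, Yᵀ * colProj (Y + Z * B) * Y = (1 + Bᵀ * B)⁻¹ := fun B => by
    rw [colProj, hV, Matrix.mul_assoc, Matrix.mul_assoc, hVY, Matrix.mul_one, ← Matrix.mul_assoc,
      hYV, Matrix.one_mul]
  have hZP : ∀ B : Matrix l m ℝ, Zᵀ * colProj (Y + Z * B) * Y = B * (1 + Bᵀ * B)⁻¹ := fun B => by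
    rw [colProj, hV, Matrix.mul_assoc, Matrix.mul_assoc, hVY, Matrix.mul_one, ← Matrix.mul_assoc,
      hZV]
  -- The column space of `Y + Z B` is the graph of `B` from the range of `Y` to that of `Z`. A
  -- projection `P` has such a range when `Yᵀ P Y` is invertible, and `B` is recovered as the ratio
  -- of the `Z`- and `Y`-components of `P Y`.
  refine LocalParam.nonempty_of_finrank (E' := Matrix l m ℝ) (U := {P | (Yᵀ * P * Y).det ≠ 0})
    (W := univ) (r := fun P => Zᵀ * P * Y * (Yᵀ * P * Y)⁻¹) (p := fun B => colProj (Y + Z * B))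
    ?_ (isOpen_det_ne_zero (by fun_prop)) isOpen_univ ?_ ?_ ?_ (fun _ _ _ => mem_univ _) ?_ ?_ ?_ ?_
  · rw [Module.finrank_matrix, Module.finrank_self, mul_one, mul_comm, hd]
  · have h : Yᵀ * (Y * Yᵀ) * Y = 1 := by rw [← Matrix.mul_assoc, hY, Matrix.one_mul, hY]
    simp [h]
  · intro P hP
    apply ContDiffAt.contDiffWithinAt
    exact ((contDiffAt_const.matrix_mul contDiffAt_id).matrix_mul contDiffAt_const).matrix_mul
      (((contDiffAt_const.matrix_mul contDiffAt_id).matrix_mul contDiffAt_const).matrix_inv hP)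
  · intro B _
    apply ContDiffAt.contDiffWithinAt
    exact (contDiffAt_colProj (hVdet B)).comp B
      (contDiffAt_const.add (contDiffAt_const.matrix_mul contDiffAt_id))
  · intro B _
    rw [mem_ofPred_eq, hYP, Matrix.det_nonsing_inv, Ring.inverse_eq_inv']
    exact inv_ne_zero (det_one_add_transpose_mul_self_ne_zero B)
  · intro B _
    exact ⟨colProj_transpose _, colProj_mul_colProj (hVdet B), by rw [trace_colProj (hVdet B), hc]⟩
  · intro B _
    have h := (det_one_add_transpose_mul_self_ne_zero B).isUnit
    change Zᵀ * colProj (Y + Z * B) * Y * (Yᵀ * colProj (Y + Z * B) * Y)⁻¹ = B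
    rw [hYP, hZP, Matrix.nonsing_inv_nonsing_inv _ h, Matrix.mul_assoc, Matrix.nonsing_inv_mul _ h,
      Matrix.mul_one]
  · rintro P hPU ⟨hP, hP', htr⟩
    set B := Zᵀ * P * Y * (Yᵀ * P * Y)⁻¹ with hB
    -- The columns of `Y + Z B` lie in the range of `P`; equality of traces then forces `P` to be
    -- the projection onto their span.
    have hVP : Y + Z * B = P * Y * (Yᵀ * P * Y)⁻¹ := by
      have h1 : P * Y = Y * (Yᵀ * P * Y) + Z * (Zᵀ * P * Y) := by
        have h2 : (Y * Yᵀ + Z * Zᵀ) * (P * Y) = P * Y := by rw [hsum, Matrix.one_mul]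
        rw [← h2, Matrix.add_mul]
        simp only [Matrix.mul_assoc]
      rw [h1, Matrix.add_mul, Matrix.mul_assoc Y, Matrix.mul_nonsing_inv _ (isUnit_iff_ne_zero.2 hPU),
        Matrix.mul_one, hB]
      simp only [Matrix.mul_assoc]
    have hPV : P * (Y + Z * B) = Y + Z * B := by
      rw [hVP, ← Matrix.mul_assoc, ← Matrix.mul_assoc, hP']
    refine (projection_eq_of_mul_eq hP hP' (colProj_transpose _) (colProj_mul_colProj (hVdet B))
      ?_ ?_).symm
    · rw [colProj, ← Matrix.mul_assoc, ← Matrix.mul_assoc, hPV]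
    · rw [htr, trace_colProj (hVdet B), hc]

end Projections

/-! ### Orthonormal frames as a regular level set. -/

section Stiefel

/-- The Stiefel manifold is a regular level set of `Y ↦ Yᵀ * Y`. -/
theorem nonempty_localParam_stiefel {k n : ℕ} {Y : Matrix (Fin n) (Fin k) ℝ} (hY : Yᵀ * Y = 1)
    {d : ℕ} (hd : n * k = (k + 1).choose 2 + d) :
    Nonempty (LocalParam {Y : Matrix (Fin n) (Fin k) ℝ | Yᵀ * Y = 1} d Y) := by
  have hsymm : ∀ (Y : Matrix (Fin n) (Fin k) ℝ) (i j : Fin k),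
      (Yᵀ * Y - 1 : Matrix (Fin k) (Fin k) ℝ) i j = (Yᵀ * Y - 1 : Matrix (Fin k) (Fin k) ℝ) j i := fun Y i j => by
    have : (Yᵀ * Y - 1)ᵀ = Yᵀ * Y - 1 := by simp
    exact congrFun (congrFun this j) i
  -- Indexing by unordered pairs keeps each entry of the symmetric matrix once. The target then has
  -- dimension `(k + 1).choose 2`, and the derivative can be surjective.
  let f : Matrix (Fin n) (Fin k) ℝ → Sym2 (Fin k) → ℝ := fun Y z =>
    Sym2.lift ⟨fun i j => (Yᵀ * Y - 1 : Matrix (Fin k) (Fin k) ℝ) i j, hsymm Y⟩ z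
  have hfij : ∀ Y i j, f Y s(i, j) = (Yᵀ * Y - 1 : Matrix (Fin k) (Fin k) ℝ) i j := fun Y i j => rfl
  have hf : ContDiff ℝ ∞ f := by
    refine contDiff_pi.2 fun z => ?_
    induction z with
    | h i j =>
      simp only [hfij]
      refine (contDiff_matrix_entry i j).comp (ContDiff.sub ?_ contDiff_const)
      exact contDiff_iff_contDiffAt.2 fun A => contDiffAt_id.matrix_transpose.matrix_mul contDiffAt_id
  have hset : {Y : Matrix (Fin n) (Fin k) ℝ | Yᵀ * Y = 1} = {Y | f Y = 0} := by
    ext A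
    constructor
    · intro h
      funext z
      induction z with
      | h i j => simp [hfij, show Aᵀ * A = 1 from h]
    · intro h
      have h1 : Aᵀ * A - 1 = 0 := by
        ext i j
        exact congrFun (show f A = 0 from h) s(i, j)
      exact sub_eq_zero.1 h1
  let S : (Sym2 (Fin k) → ℝ) →ₗ[ℝ] Matrix (Fin k) (Fin k) ℝ :=
    { toFun := fun w => Matrix.of fun i j => w s(i, j)
      map_add' := fun _ _ => rfl
      map_smul' := fun _ _ => rfl }
  -- At an orthonormal `Y` the derivative sends `H` to `Hᵀ Y + Yᵀ H`, so `H = (1/2) Y S` with `S`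
  -- symmetric is sent to `S`.
  let s : (Sym2 (Fin k) → ℝ) →L[ℝ] Matrix (Fin n) (Fin k) ℝ :=
    ((mulBilin _ _ _ ((1 / 2 : ℝ) • Y)).toLinearMap ∘ₗ S).toContinuousLinearMap
  have hs : ∀ w, s w = (1 / 2 : ℝ) • Y * S w := fun w => rfl
  rw [hset]
  refine LocalParam.nonempty_of_levelSet hf s (fun w => ?_) ?_
  · have h1 : HasDerivAt (fun t : ℝ => Y + t • s w) (s w) 0 := by
      have := ((hasDerivAt_id (0 : ℝ)).smul_const (s w)).const_add Y
      rwa [one_smul] at this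
    have h2 : HasFDerivAt f (fderiv ℝ f Y) (Y + (0 : ℝ) • s w) := by
      rw [zero_smul, add_zero]
      exact (hf.differentiable (by simp) Y).hasFDerivAt
    have h3 := h2.comp_hasDerivAt 0 h1
    refine h3.unique (hasDerivAt_pi.2 fun z => ?_)
    induction z with
    | h i j =>
      have hST : (S w)ᵀ = S w := by
        ext a b
        exact congrArg w Sym2.eq_swap
      have h4 : ∀ t : ℝ, (f ∘ fun t => Y + t • s w) t s(i, j) =
          t * w s(i, j) + t ^ 2 * ((1 / 4 : ℝ) * (S w * S w) i j) := by
        intro t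
        have h5 : (Y + t • s w)ᵀ * (Y + t • s w) - 1 =
            t • S w + t ^ 2 • ((1 / 4 : ℝ) • (S w * S w)) := by
          have h6 : Yᵀ * (Y * S w) = S w := by rw [← Matrix.mul_assoc, hY, Matrix.one_mul]
          have h7 : S w * Yᵀ * Y = S w := by rw [Matrix.mul_assoc, hY, Matrix.mul_one]
          have h8 : S w * Yᵀ * (Y * S w) = S w * S w := by rw [← Matrix.mul_assoc, h7]
          simp only [hs, Matrix.transpose_add, Matrix.transpose_smul, Matrix.transpose_mul, hST,
            Matrix.add_mul, Matrix.mul_add, Matrix.smul_mul, Matrix.mul_smul, hY, h6, h7, h8]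
          module
        have := congrFun (congrFun h5 i) j
        exact this
      simp only [h4]
      have h9 := ((hasDerivAt_id (0 : ℝ)).mul_const (w s(i, j))).add
        (((hasDerivAt_id (0 : ℝ)).pow 2).mul_const ((1 / 4 : ℝ) * (S w * S w) i j))
      exact h9.congr_deriv (by simp)
  · rw [Module.finrank_matrix, Module.finrank_self, mul_one, Module.finrank_fintype_fun_eq_card,
      Sym2.card, Fintype.card_fin, Fintype.card_fin, hd]

end Stiefel

end Grassmann

namespace Grassmann

/-! ### Eigenbases and QR factorizations. -/

section Frames

variable {k n : ℕ}

/-- The matrix consisting of the last `n - k` columns of an orthogonal matrix. -/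
def lastColumns (h : k ≤ n) (W : O n) : Matrix (Fin n) (Fin (n - k)) ℝ :=
  (W : Matrix (Fin n) (Fin n) ℝ).submatrix id (blockEquiv h ∘ Sum.inr)

theorem blockEquiv_comp_inl (h : k ≤ n) : blockEquiv h ∘ Sum.inl = Fin.castLE h := by
  funext i
  apply Fin.ext
  simp [blockEquiv]

theorem orthogonal_transpose_mul_self (W : O n) :
    (W : Matrix (Fin n) (Fin n) ℝ)ᵀ * (W : Matrix (Fin n) (Fin n) ℝ) = 1 :=
  (Matrix.mem_orthogonalGroup_iff' (Fin n) ℝ).1 W.2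

theorem orthogonal_mul_transpose_self (W : O n) :
    (W : Matrix (Fin n) (Fin n) ℝ) * (W : Matrix (Fin n) (Fin n) ℝ)ᵀ = 1 :=
  (Matrix.mem_orthogonalGroup_iff (Fin n) ℝ).1 W.2

theorem submatrix_blockEquiv (h : k ≤ n) (W : O n) :
    (W : Matrix (Fin n) (Fin n) ℝ).submatrix id (blockEquiv h) =
      Matrix.fromCols (firstColumns h W).1 (lastColumns h W) := by
  ext i (j | j)
  · simp [firstColumns, ← blockEquiv_comp_inl h]
  · simp [lastColumns]

theorem signature_submatrix (h : k ≤ n) :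
    (signature h).submatrix (blockEquiv h) (blockEquiv h) = Matrix.fromBlocks 1 0 0 (-1) := by
  simp [signature]

theorem firstColumns_add_lastColumns (h : k ≤ n) (W : O n) :
    (firstColumns h W).1 * (firstColumns h W).1ᵀ + lastColumns h W * (lastColumns h W)ᵀ = 1 := by
  rw [← orthogonal_mul_transpose_self W, ← Matrix.fromCols_mul_fromRows, ← Matrix.transpose_fromCols,
    ← submatrix_blockEquiv, Matrix.transpose_submatrix, Matrix.submatrix_mul_equiv,
    Matrix.submatrix_id_id]

/-- With `Y` and `Z` the first and last columns, the left side is `Y Yᵀ - Z Zᵀ`, while orthogonality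
of `W` says `Y Yᵀ + Z Zᵀ = 1`. -/
theorem mul_signature_mul_transpose (h : k ≤ n) (W : O n) :
    (W : Matrix (Fin n) (Fin n) ℝ) * signature h * (W : Matrix (Fin n) (Fin n) ℝ)ᵀ =
      (2 : ℝ) • ((firstColumns h W).1 * (firstColumns h W).1ᵀ) - 1 := by
  have h1 : (W : Matrix (Fin n) (Fin n) ℝ) * signature h * (W : Matrix (Fin n) (Fin n) ℝ)ᵀ =
      (firstColumns h W).1 * (firstColumns h W).1ᵀ - lastColumns h W * (lastColumns h W)ᵀ := by
    have h2 := Matrix.submatrix_mul_equiv ((W : Matrix (Fin n) (Fin n) ℝ) * signature h)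
      (W : Matrix (Fin n) (Fin n) ℝ)ᵀ id (blockEquiv h) id
    rw [← Matrix.submatrix_mul_equiv _ _ _ (blockEquiv h), ← Matrix.transpose_submatrix,
      submatrix_blockEquiv, signature_submatrix, Matrix.fromCols_mul_fromBlocks,
      Matrix.transpose_fromCols, Matrix.fromCols_mul_fromRows, Matrix.submatrix_id_id] at h2
    rw [← h2]
    simp [sub_eq_add_neg]
  rw [h1, ← firstColumns_add_lastColumns h W]
  module

theorem lastColumns_transpose_mul_self (h : k ≤ n) (W : O n) :
    (lastColumns h W)ᵀ * lastColumns h W = 1 := by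
  rw [lastColumns, Matrix.transpose_submatrix, ← Matrix.submatrix_mul _ _ _ id _
    Function.bijective_id, orthogonal_transpose_mul_self]
  exact Matrix.submatrix_one _ ((blockEquiv h).injective.comp Sum.inr_injective)

theorem firstColumns_transpose_mul_lastColumns (h : k ≤ n) (W : O n) :
    (firstColumns h W).1ᵀ * lastColumns h W = 0 := by
  rw [lastColumns, firstColumns, Matrix.transpose_submatrix, ← Matrix.submatrix_mul _ _ _ id _
    Function.bijective_id, orthogonal_transpose_mul_self, ← blockEquiv_comp_inl]
  ext i j
  simp

theorem signature_eq_diagonal (h : k ≤ n) : signature h =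
    Matrix.diagonal (Sum.elim (fun _ => (1 : ℝ)) (fun _ => -1) ∘ (blockEquiv h).symm) := by
  rw [signature, ← Matrix.diagonal_one, ← Matrix.diagonal_one, Matrix.diagonal_neg,
    Matrix.fromBlocks_diagonal]
  simp

/-- Every symmetric involution of trace `2k - n` has an orthonormal eigenbasis. -/
theorem exists_isEigenbasis (h : k ≤ n) (Q : InvolutionModel k n) : ∃ W, IsEigenbasis h Q W := by
  obtain ⟨Q, hQ, hQT, htr⟩ := Q
  have hsq : Q * Q = 1 := by
    have := (Matrix.mem_orthogonalGroup_iff (Fin n) ℝ).1 hQ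
    rwa [hQT] at this
  have hH : Q.IsHermitian := by
    rw [Matrix.IsHermitian, Matrix.conjTranspose_eq_transpose_of_trivial, hQT]
  set lam := hH.eigenvalues
  set B : Matrix (Fin n) (Fin n) ℝ := hH.eigenvectorUnitary.1
  have hB : Bᵀ * B = 1 := by
    have := Matrix.UnitaryGroup.star_mul_self hH.eigenvectorUnitary
    rwa [Matrix.star_eq_conjTranspose, Matrix.conjTranspose_eq_transpose_of_trivial] at this
  have hspec : Q = B * Matrix.diagonal lam * Bᵀ := by
    have := hH.spectral_theorem
    rwa [Unitary.conjStarAlgAut_apply, Matrix.star_eq_conjTranspose,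
      Matrix.conjTranspose_eq_transpose_of_trivial] at this
  have hlam : ∀ i, lam i = 1 ∨ lam i = -1 := by
    intro i
    have h1 : Matrix.diagonal lam = Bᵀ * Q * B := by
      rw [hspec]
      calc Matrix.diagonal lam = (Bᵀ * B) * Matrix.diagonal lam * (Bᵀ * B) := by simp [hB]
        _ = _ := by simp only [Matrix.mul_assoc]
    have h2 : Matrix.diagonal lam * Matrix.diagonal lam = 1 := by
      have hB' : B * Bᵀ = 1 := mul_eq_one_comm.1 hB
      calc Matrix.diagonal lam * Matrix.diagonal lam = Bᵀ * Q * (B * Bᵀ) * Q * B := by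
            rw [h1]; simp only [Matrix.mul_assoc]
        _ = Bᵀ * (Q * Q) * B := by rw [hB']; simp only [Matrix.mul_assoc, Matrix.one_mul]
        _ = 1 := by rw [hsq, Matrix.mul_one, hB]
    rw [Matrix.diagonal_mul_diagonal] at h2
    have h3 := congrFun (congrFun h2 i) i
    simp only [Matrix.diagonal_apply_eq, Matrix.one_apply_eq] at h3
    exact mul_self_eq_one_iff.1 h3
  -- As the eigenvalues are `±1`, the trace is twice the number of ones minus `n`.
  have hcard : Fintype.card {i // lam i = 1} = k := by
    have h1 : Q.trace = ∑ i, lam i := by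
      rw [hspec, Matrix.mul_assoc, Matrix.trace_mul_comm, Matrix.mul_assoc, hB, Matrix.mul_one,
        Matrix.trace_diagonal]
    have h2 : ∀ i, lam i = 2 * (if lam i = 1 then 1 else 0) - 1 := by
      intro i
      rcases hlam i with hi | hi <;> rw [hi] <;> norm_num
    rw [htr, Finset.sum_congr rfl fun i _ => h2 i, Finset.sum_sub_distrib, ← Finset.mul_sum,
      Finset.sum_boole] at h1
    rw [Fintype.card_subtype]
    simp only [Finset.sum_const, Finset.card_univ, Fintype.card_fin, nsmul_eq_mul, mul_one] at h1
    have h3 : ((Finset.univ.filter fun i => lam i = 1).card : ℝ) = k := by linarith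
    exact_mod_cast h3
  let e1 : Fin k ≃ {i // lam i = 1} := (Fintype.equivFinOfCardEq hcard).symm
  let e2 : Fin (n - k) ≃ {i // ¬ lam i = 1} := (Fintype.equivFinOfCardEq (by
    rw [Fintype.card_subtype_compl, hcard, Fintype.card_fin])).symm
  -- The permutation lists the eigenvectors of eigenvalue `1` first, as `signature` requires.
  let σ : Fin n ≃ Fin n := (blockEquiv h).symm.trans
    ((Equiv.sumCongr e1 e2).trans (Equiv.sumCompl fun i => lam i = 1))
  have hσ : lam ∘ σ = Sum.elim (fun _ => (1 : ℝ)) (fun _ => -1) ∘ (blockEquiv h).symm := by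
    funext i
    rcases hi : (blockEquiv h).symm i with j | j
    · simp [σ, hi, (e1 j).2]
    · simp [σ, hi, (hlam (e2 j)).resolve_left (e2 j).2]
  refine ⟨⟨B.submatrix id σ, ?_⟩, ?_⟩
  · rw [Matrix.mem_orthogonalGroup_iff', Matrix.transpose_submatrix,
      ← Matrix.submatrix_mul _ _ _ id _ Function.bijective_id, hB, Matrix.submatrix_one_equiv]
  · change Q = B.submatrix id σ * signature h * (B.submatrix id σ)ᵀ
    rw [signature_eq_diagonal, ← hσ, ← Matrix.submatrix_diagonal_equiv, Matrix.submatrix_mul_equiv,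
      Matrix.transpose_submatrix, Matrix.submatrix_mul_equiv, Matrix.submatrix_id_id, ← hspec]

/-- Every matrix of full column rank has a QR factorization. -/
theorem exists_isQR (A : FullRank k n) : ∃ Y R, IsQR A Y R := by
  obtain ⟨A, hA⟩ := A
  have hdet := det_transpose_mul_self_ne_zero_iff.2 hA
  let f : Fin k → EuclideanSpace ℝ (Fin n) := fun j => WithLp.toLp 2 fun i => A i j
  have hf : LinearIndependent ℝ f := by
    rw [Fintype.linearIndependent_iff]
    intro c hc
    have h1 : A *ᵥ c = 0 := by
      funext i
      have := congrArg (fun v : EuclideanSpace ℝ (Fin n) => v i) hc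
      simpa [f, Matrix.mulVec, dotProduct, mul_comm] using this
    have h2 : (Aᵀ * A) *ᵥ c = 0 := by rw [← Matrix.mulVec_mulVec, h1, Matrix.mulVec_zero]
    exact congrFun (Matrix.eq_zero_of_mulVec_eq_zero hdet h2)
  set g := InnerProductSpace.gramSchmidtNormed ℝ f
  have hg : Orthonormal ℝ g := InnerProductSpace.gramSchmidtNormed_orthonormal hf
  have hspan : ∀ j, f j ∈ Submodule.span ℝ (g '' Set.Iic j) := by
    intro j
    rw [InnerProductSpace.span_gramSchmidtNormed, InnerProductSpace.span_gramSchmidt_Iic]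
    exact Submodule.subset_span ⟨j, Set.mem_Iic.2 le_rfl, rfl⟩
  -- Column `j` lies in the span of the Gram–Schmidt vectors up to `j`. Its later coefficients
  -- vanish, which makes `R` upper triangular, and its Fourier expansion is the product `Y R`.
  have key : ∀ j, ∀ x ∈ Submodule.span ℝ (g '' Set.Iic j),
      (∀ i, j < i → inner ℝ (g i) x = 0) ∧ ∑ i, inner ℝ (g i) x • g i = x := by
    intro j x hx
    induction hx using Submodule.span_induction with
    | mem x hx =>
      obtain ⟨l, hl, rfl⟩ := hx
      refine ⟨fun i hi => hg.2 (ne_of_gt (lt_of_le_of_lt hl hi)), ?_⟩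
      simp [orthonormal_iff_ite.1 hg]
    | zero => simp
    | add x y _ _ hx hy =>
      refine ⟨fun i hi => by rw [inner_add_right, hx.1 i hi, hy.1 i hi, add_zero], ?_⟩
      simp only [inner_add_right, add_smul, Finset.sum_add_distrib, hx.2, hy.2]
    | smul c x _ hx =>
      refine ⟨fun i hi => by rw [inner_smul_right, hx.1 i hi, mul_zero], ?_⟩
      simp only [inner_smul_right, mul_smul, ← Finset.smul_sum, hx.2]
  refine ⟨⟨Matrix.of fun i j => g j i, ?_⟩, Matrix.of fun i j => inner ℝ (g i) (f j), ?_, ?_⟩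
  · ext i j
    have := orthonormal_iff_ite.1 hg i j
    rw [PiLp.inner_apply] at this
    simpa [Matrix.mul_apply, Matrix.one_apply, mul_comm] using this
  · intro i j hij
    exact (key j (f j) (hspan j)).1 i hij
  · ext i j
    have := congrArg (fun v : EuclideanSpace ℝ (Fin n) => v i) (key j (f j) (hspan j)).2
    simpa [Matrix.mul_apply, mul_comm, f] using this.symm

end Frames

end Grassmann

/-! ### The maps to the involution model, their fibres and local sections. -/

namespace Grassmann

open Set Topology Filter

attribute [local instance] Matrix.normedAddCommGroup Matrix.normedSpace

variable {k n : ℕ}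

/-- The bijection `P ↦ 2P - 1` between the projection model and the involution model. -/
noncomputable def projectionEquiv (k n : ℕ) : ProjectionModel k n ≃ InvolutionModel k n where
  toFun P := ⟨(2 : ℝ) • P.1 - 1, by
    obtain ⟨P, hP, hP', htr⟩ := P
    have hT : ((2 : ℝ) • P - 1)ᵀ = (2 : ℝ) • P - 1 := by simp [hP]
    refine ⟨?_, hT, ?_⟩
    · rw [Matrix.mem_orthogonalGroup_iff]
      change ((2 : ℝ) • P - 1) * ((2 : ℝ) • P - 1)ᵀ = 1
      rw [hT]
      simp only [sub_mul, mul_sub, Matrix.smul_mul, Matrix.mul_smul, hP', one_mul, mul_one]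
      module
    · simp [Matrix.trace_sub, htr]⟩
  invFun Q := ⟨(1 / 2 : ℝ) • (1 + Q.1), by
    obtain ⟨Q, hQ, hT, htr⟩ := Q
    have hsq : Q * Q = 1 := by
      have := (Matrix.mem_orthogonalGroup_iff (Fin n) ℝ).1 hQ
      rwa [hT] at this
    refine ⟨by simp [hT], ?_, ?_⟩
    · simp only [add_mul, mul_add, Matrix.smul_mul, Matrix.mul_smul, hsq, one_mul, mul_one]
      module
    · rw [Matrix.trace_smul, Matrix.trace_add, htr, Matrix.trace_one, Fintype.card_fin, smul_eq_mul]
      ring⟩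
  left_inv P := by
    apply Subtype.ext
    change (1 / 2 : ℝ) • (1 + ((2 : ℝ) • P.1 - 1)) = P.1
    module
  right_inv Q := by
    apply Subtype.ext
    change (2 : ℝ) • ((1 / 2 : ℝ) • (1 + Q.1)) - 1 = Q.1
    module

theorem involution_mul_self (Q : InvolutionModel k n) : Q.1 * Q.1 = 1 := by
  have := (Matrix.mem_orthogonalGroup_iff (Fin n) ℝ).1 Q.2.1
  rwa [Q.2.2.1] at this

/-- The involution which is `1` on the column space of a full-rank matrix and `-1` on its
orthogonal complement. -/
noncomputable def involutionOfFullRank (A : FullRank k n) : InvolutionModel k n :=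
  projectionEquiv k n ⟨colProj A.1, colProj_transpose _,
    colProj_mul_colProj (det_transpose_mul_self_ne_zero_iff.2 A.2), by
      rw [trace_colProj (det_transpose_mul_self_ne_zero_iff.2 A.2), Fintype.card_fin]⟩

theorem colProj_of_orthonormal {Y : Matrix (Fin n) (Fin k) ℝ} (hY : Yᵀ * Y = 1) :
    colProj Y = Y * Yᵀ := by
  rw [colProj, hY, inv_one, Matrix.mul_one]

/-- The involution which is `1` on the span of an orthonormal family and `-1` on its orthogonal
complement. -/
noncomputable def involutionOfStiefel (Y : V k n) : InvolutionModel k n :=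
  involutionOfFullRank (toFullRank Y)

theorem involutionOfStiefel_coe (Y : V k n) :
    (involutionOfStiefel Y).1 = (2 : ℝ) • (Y.1 * Y.1ᵀ) - 1 := by
  change (2 : ℝ) • colProj Y.1 - 1 = _
  rw [colProj_of_orthonormal Y.2]

/-- The involution with eigenbasis given by an orthogonal matrix. -/
noncomputable def involutionOfOrthogonal (h : k ≤ n) (W : O n) : InvolutionModel k n :=
  involutionOfStiefel (firstColumns h W)

theorem involutionOfOrthogonal_coe (h : k ≤ n) (W : O n) : (involutionOfOrthogonal h W).1 =
    (W : Matrix (Fin n) (Fin n) ℝ) * signature h * (W : Matrix (Fin n) (Fin n) ℝ)ᵀ := by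
  rw [mul_signature_mul_transpose]
  exact involutionOfStiefel_coe _

theorem isEigenbasis_iff (h : k ≤ n) (Q : InvolutionModel k n) (W : O n) :
    IsEigenbasis h Q W ↔ involutionOfOrthogonal h W = Q := by
  rw [IsEigenbasis, ← involutionOfOrthogonal_coe, eq_comm, Subtype.ext_iff]

theorem involutionOfFullRank_eq_iff (A B : FullRank k n) :
    involutionOfFullRank A = involutionOfFullRank B ↔ colProj A.1 = colProj B.1 := by
  rw [involutionOfFullRank, involutionOfFullRank, (projectionEquiv k n).injective.eq_iff,
    Subtype.mk.injEq]

/-- A change of basis does not move the column space; algebraically, `X` and `Xᵀ` cancel against the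
inverse Gram matrix. -/
theorem colProj_mul_GL {A : Matrix (Fin n) (Fin k) ℝ} (X : GL (Fin k) ℝ) :
    colProj (A * (X : Matrix (Fin k) (Fin k) ℝ)) = colProj A := by
  have hX : (X : Matrix (Fin k) (Fin k) ℝ) * (X : Matrix (Fin k) (Fin k) ℝ)⁻¹ = 1 :=
    Matrix.mul_nonsing_inv _ ((Matrix.isUnit_iff_isUnit_det _).1 X.isUnit)
  have hX' : ((X : Matrix (Fin k) (Fin k) ℝ)ᵀ)⁻¹ * (X : Matrix (Fin k) (Fin k) ℝ)ᵀ = 1 := by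
    rw [← Matrix.transpose_nonsing_inv, ← Matrix.transpose_mul, hX, Matrix.transpose_one]
  set Z := (X : Matrix (Fin k) (Fin k) ℝ)
  calc colProj (A * Z) = A * (Z * Z⁻¹) * (Aᵀ * A)⁻¹ * ((Zᵀ)⁻¹ * Zᵀ) * Aᵀ := by
        rw [colProj, Matrix.transpose_mul,
          show Zᵀ * Aᵀ * (A * Z) = Zᵀ * ((Aᵀ * A) * Z) by simp only [Matrix.mul_assoc],
          Matrix.mul_inv_rev, Matrix.mul_inv_rev]
        simp only [Matrix.mul_assoc]
    _ = colProj A := by rw [hX, hX', Matrix.mul_one, Matrix.mul_one, colProj]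

/-- If the projections agree, each matrix is fixed by the other's projection. This writes `B = A X`
and `A = B X'` with explicit coefficients, and full column rank gives `X X' = 1`. -/
theorem fullRankMk_eq_iff (A B : FullRank k n) :
    fullRankMk A = fullRankMk B ↔ involutionOfFullRank A = involutionOfFullRank B := by
  rw [involutionOfFullRank_eq_iff]
  constructor
  · intro h
    obtain ⟨X, hX⟩ : ∃ X : GL (Fin k) ℝ, B.1 = A.1 * (X : Matrix (Fin k) (Fin k) ℝ) :=
      Quotient.exact h
    rw [hX, colProj_mul_GL]
  · intro h
    have hA := det_transpose_mul_self_ne_zero_iff.2 A.2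
    have hB := det_transpose_mul_self_ne_zero_iff.2 B.2
    have h1 : B.1 = A.1 * ((A.1ᵀ * A.1)⁻¹ * A.1ᵀ * B.1) := by
      rw [← Matrix.mul_assoc, ← Matrix.mul_assoc]
      change B.1 = colProj A.1 * B.1
      rw [h, colProj_mul_self hB]
    have h2 : A.1 = B.1 * ((B.1ᵀ * B.1)⁻¹ * B.1ᵀ * A.1) := by
      rw [← Matrix.mul_assoc, ← Matrix.mul_assoc]
      change A.1 = colProj B.1 * A.1
      rw [← h, colProj_mul_self hA]
    set X := (A.1ᵀ * A.1)⁻¹ * A.1ᵀ * B.1 with hX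
    have h3 : X * ((B.1ᵀ * B.1)⁻¹ * B.1ᵀ * A.1) = 1 := by
      rw [hX, Matrix.mul_assoc _ B.1, ← h2, Matrix.mul_assoc, Matrix.nonsing_inv_mul _ hA.isUnit]
    exact Quotient.sound ⟨⟨X, _, h3, mul_eq_one_comm.1 h3⟩, h1⟩

/-- If `Y Yᵀ = Z Zᵀ`, the transition matrix is `Yᵀ Z`, which is orthogonal. -/
theorem stiefelMk_eq_iff (Y Z : V k n) :
    stiefelMk Y = stiefelMk Z ↔ involutionOfStiefel Y = involutionOfStiefel Z := by
  rw [involutionOfStiefel, involutionOfStiefel, involutionOfFullRank_eq_iff]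
  change _ ↔ colProj Y.1 = colProj Z.1
  rw [colProj_of_orthonormal Y.2, colProj_of_orthonormal Z.2]
  constructor
  · intro h
    obtain ⟨Q, hQ⟩ : ∃ Q : O k, Z.1 = Y.1 * (Q : Matrix (Fin k) (Fin k) ℝ) := Quotient.exact h
    rw [hQ, Matrix.transpose_mul, Matrix.mul_assoc, ← Matrix.mul_assoc _ _ Y.1ᵀ,
      orthogonal_mul_transpose_self, Matrix.one_mul]
  · intro h
    have h1 : (Y.1ᵀ * Z.1)ᵀ * (Y.1ᵀ * Z.1) = 1 := by
      calc (Y.1ᵀ * Z.1)ᵀ * (Y.1ᵀ * Z.1) = Z.1ᵀ * (Y.1 * Y.1ᵀ) * Z.1 := by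
            simp [Matrix.mul_assoc]
        _ = (Z.1ᵀ * Z.1) * (Z.1ᵀ * Z.1) := by rw [h]; simp only [Matrix.mul_assoc]
        _ = 1 := by rw [Z.2, Matrix.one_mul]
    refine Quotient.sound ⟨⟨Y.1ᵀ * Z.1, (Matrix.mem_orthogonalGroup_iff' _ _).2 h1⟩, ?_⟩
    change Z.1 = Y.1 * (Y.1ᵀ * Z.1)
    rw [← Matrix.mul_assoc, h, Matrix.mul_assoc, Z.2, Matrix.mul_one]

theorem blockDiag_coe (h : k ≤ n) (q : O k × O (n - k)) :
    ((blockDiag h q : O n) : Matrix (Fin n) (Fin n) ℝ) =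
      Matrix.reindex (blockEquiv h) (blockEquiv h) (Matrix.fromBlocks q.1.1 0 0 q.2.1) := rfl

/-- The orthogonal matrices commuting with `I_{k,n-k}` are the block diagonal ones. -/
theorem mem_range_blockDiag_iff (h : k ≤ n) (D : O n) : D ∈ (blockDiag h).range ↔
    (D : Matrix (Fin n) (Fin n) ℝ) * signature h = signature h * D := by
  constructor
  · rintro ⟨q, rfl⟩
    rw [blockDiag_coe, signature, Matrix.reindex_apply, Matrix.reindex_apply,
      Matrix.submatrix_mul_equiv, Matrix.submatrix_mul_equiv, Matrix.fromBlocks_multiply,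
      Matrix.fromBlocks_multiply]
    simp
  · intro hD
    set D' := (D : Matrix (Fin n) (Fin n) ℝ).submatrix (blockEquiv h) (blockEquiv h) with hD'
    have h1 : D' * Matrix.fromBlocks 1 0 0 (-1) = Matrix.fromBlocks 1 0 0 (-1) * D' := by
      rw [← signature_submatrix h, hD', Matrix.submatrix_mul_equiv, Matrix.submatrix_mul_equiv, hD]
    have h2 : D' * D'ᵀ = 1 := by
      rw [hD', Matrix.transpose_submatrix, Matrix.submatrix_mul_equiv,
        orthogonal_mul_transpose_self, Matrix.submatrix_one_equiv]
    have h3 : D' = Matrix.fromBlocks D'.toBlocks₁₁ D'.toBlocks₁₂ D'.toBlocks₂₁ D'.toBlocks₂₂ :=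
      (Matrix.fromBlocks_toBlocks D').symm
    rw [h3, Matrix.fromBlocks_multiply, Matrix.fromBlocks_multiply, Matrix.fromBlocks_inj] at h1
    obtain ⟨-, h12, h21, -⟩ := h1
    have h12' : D'.toBlocks₁₂ = 0 := by
      have : -D'.toBlocks₁₂ = D'.toBlocks₁₂ := by simpa using h12
      ext i j
      have := congrFun (congrFun this i) j
      rw [Matrix.neg_apply] at this
      rw [Matrix.zero_apply]
      linarith
    have h21' : D'.toBlocks₂₁ = 0 := by
      have : D'.toBlocks₂₁ = -D'.toBlocks₂₁ := by simpa using h21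
      ext i j
      have := congrFun (congrFun this i) j
      rw [Matrix.neg_apply] at this
      rw [Matrix.zero_apply]
      linarith
    rw [h12', h21'] at h3
    rw [h3, Matrix.fromBlocks_transpose, Matrix.fromBlocks_multiply, ← Matrix.fromBlocks_one,
      Matrix.fromBlocks_inj] at h2
    refine ⟨(⟨D'.toBlocks₁₁, (Matrix.mem_orthogonalGroup_iff _ _).2 (by simpa using h2.1)⟩,
      ⟨D'.toBlocks₂₂, (Matrix.mem_orthogonalGroup_iff _ _).2 (by simpa using h2.2.2.2)⟩), ?_⟩
    apply Subtype.ext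
    rw [blockDiag_coe]
    change Matrix.reindex _ _ (Matrix.fromBlocks D'.toBlocks₁₁ 0 0 D'.toBlocks₂₂) = _
    rw [← h3, hD']
    simp

/-- Two conjugates of `I_{k,n-k}` agree exactly when `W⁻¹ Z` commutes with it, that is, when `W⁻¹ Z`
is block diagonal. -/
theorem orthogonalMk_eq_iff (h : k ≤ n) (W Z : O n) : orthogonalMk h W = orthogonalMk h Z ↔
    involutionOfOrthogonal h W = involutionOfOrthogonal h Z := by
  rw [Subtype.ext_iff, involutionOfOrthogonal_coe, involutionOfOrthogonal_coe, orthogonalMk,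
    orthogonalMk, QuotientGroup.eq, mem_range_blockDiag_iff]
  have hinv : ((W⁻¹ * Z : O n) : Matrix (Fin n) (Fin n) ℝ) =
      (W : Matrix (Fin n) (Fin n) ℝ)ᵀ * (Z : Matrix (Fin n) (Fin n) ℝ) := rfl
  rw [hinv]
  have hW := orthogonal_transpose_mul_self W
  have hW' := orthogonal_mul_transpose_self W
  have hZ := orthogonal_transpose_mul_self Z
  have hZ' := orthogonal_mul_transpose_self Z
  set A := (W : Matrix (Fin n) (Fin n) ℝ)
  set B := (Z : Matrix (Fin n) (Fin n) ℝ)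
  constructor
  · intro h1
    calc A * signature h * Aᵀ = A * (signature h * (Aᵀ * B)) * Bᵀ := by
          simp only [Matrix.mul_assoc, hZ', Matrix.mul_one]
      _ = A * Aᵀ * B * signature h * Bᵀ := by rw [← h1]; simp only [Matrix.mul_assoc]
      _ = B * signature h * Bᵀ := by rw [hW', Matrix.one_mul]
  · intro h1
    calc Aᵀ * B * signature h = Aᵀ * (B * signature h * Bᵀ) * B := by
          simp only [Matrix.mul_assoc, hZ, Matrix.mul_one]
      _ = (Aᵀ * A) * signature h * (Aᵀ * B) := by rw [← h1]; simp only [Matrix.mul_assoc]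
      _ = signature h * (Aᵀ * B) := by rw [hW, Matrix.one_mul]

/-- Since `Aᵀ A = Rᵀ R` is invertible, so is `R`; hence `A` and `Y` have the same column space. This
also gives independence of the chosen factorization. -/
theorem involutionOfFullRank_eq_of_isQR {A : FullRank k n} {Y : V k n} {R} (h : IsQR A Y R) :
    involutionOfFullRank A = involutionOfStiefel Y := by
  have hdet : IsUnit R := by
    have h1 := det_transpose_mul_self_ne_zero_iff.2 A.2
    have h2 : A.1ᵀ * A.1 = Rᵀ * R := by
      rw [h.2, Matrix.transpose_mul, Matrix.mul_assoc, ← Matrix.mul_assoc _ Y.1, Y.2,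
        Matrix.one_mul]
    rw [h2, Matrix.det_mul] at h1
    rw [Matrix.isUnit_iff_isUnit_det]
    exact (right_ne_zero_of_mul h1).isUnit
  obtain ⟨X, rfl⟩ := hdet
  rw [involutionOfStiefel, involutionOfFullRank_eq_iff, h.2, colProj_mul_GL]
  rfl

/-- The spectral theorem settles this case, and the next two inherit it because each involution map
is defined through the following model. -/
theorem involutionOfOrthogonal_surjective (h : k ≤ n) :
    Function.Surjective (involutionOfOrthogonal h) := fun Q => by
  obtain ⟨W, hW⟩ := exists_isEigenbasis h Q
  exact ⟨W, (isEigenbasis_iff h Q W).1 hW⟩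

theorem involutionOfStiefel_surjective (h : k ≤ n) :
    Function.Surjective (involutionOfStiefel (k := k) (n := n)) := fun Q => by
  obtain ⟨W, hW⟩ := involutionOfOrthogonal_surjective h Q
  exact ⟨firstColumns h W, hW⟩

theorem involutionOfFullRank_surjective (h : k ≤ n) :
    Function.Surjective (involutionOfFullRank (k := k) (n := n)) := fun Q => by
  obtain ⟨Y, hY⟩ := involutionOfStiefel_surjective h Q
  exact ⟨toFullRank Y, hY⟩

/-- A model of the Grassmannian on which the orthogonal group acts compatibly with its action by
conjugation on involutions is a quotient model. -/
theorem isQuotientModel_of_equivariant {m : ℕ} {p : Matrix (Fin n) (Fin m) ℝ → Prop} {N : Type}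
    [TopologicalSpace N] {π : {A // p A} → N} {Ψ : {A // p A} → InvolutionModel k n}
    {f : Matrix (Fin n) (Fin m) ℝ → Matrix (Fin n) (Fin n) ℝ} (hπ : IsQuotientMap π)
    (hfib : ∀ x y, π x = π y ↔ Ψ x = Ψ y) (hsurj : Function.Surjective Ψ)
    (hf : ∀ A, p A → ContDiffAt ℝ ∞ f A) (hfΨ : ∀ A, (Ψ A).1 = f A.1)
    (hp : ∀ (U : Matrix (Fin n) (Fin n) ℝ) A, U * Uᵀ = 1 → p A → p (U * A))
    (hequiv : ∀ (U : Matrix (Fin n) (Fin n) ℝ) A, U * Uᵀ = 1 → p A →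
      f (U * A) = U * f A * Uᵀ) :
    IsQuotientModel (fun A => A.1) (fun Q => Q.1) π Ψ := by
  refine ⟨hπ, hfib, hsurj, fun x => ⟨f, hf x.1 x.2, hfΨ⟩, fun x => ?_⟩
  obtain ⟨U, hU, hU1, hUc⟩ := exists_local_conj (Ψ x).2.2.1 (involution_mul_self (Ψ x))
  have hUc' : ∀ᶠ Q : InvolutionModel k n in 𝓝 (Ψ x),
      U Q.1 * (U Q.1)ᵀ = 1 ∧ U Q.1 * (Ψ x).1 * (U Q.1)ᵀ = Q.1 := by
    filter_upwards [continuous_subtype_val.continuousAt.eventually hUc] with Q hQ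
    exact hQ Q.2.2.1 (involution_mul_self Q)
  classical
  -- The section moves `x` by the conjugating matrix `U Q`. The value `x` in the other branch only
  -- makes it total: near the base point `U Q` is orthogonal.
  refine ⟨fun Q => if h : U Q.1 * (U Q.1)ᵀ = 1 then ⟨U Q.1 * x.1, hp _ _ h x.2⟩ else x,
    fun Q => U Q * x.1, hU.matrix_mul contDiffAt_const, ?_, ?_, ?_⟩
  · simp [hU1]
  · filter_upwards [hUc'] with Q hQ
    rw [dif_pos hQ.1]
    apply Subtype.ext
    rw [hfΨ]
    change f (U Q.1 * x.1) = Q.1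
    rw [hequiv _ _ hQ.1 x.2, ← hfΨ, hQ.2]
  · filter_upwards [hUc'] with Q hQ
    rw [dif_pos hQ.1]

theorem isQuotientModel_orthogonal (h : k ≤ n) : IsQuotientModel
    (fun W : O n => (W : Matrix (Fin n) (Fin n) ℝ)) (fun Q : InvolutionModel k n => Q.1)
    (orthogonalMk h) (involutionOfOrthogonal h) := by
  refine isQuotientModel_of_equivariant (p := (· ∈ Matrix.orthogonalGroup (Fin n) ℝ))
    (f := fun W => W * signature h * Wᵀ) isQuotientMap_quotient_mk'
    (orthogonalMk_eq_iff h) (involutionOfOrthogonal_surjective h) ?_ (involutionOfOrthogonal_coe h)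
    ?_ ?_
  · intro W _
    have h1 : ContDiffAt ℝ ∞ (fun W : Matrix (Fin n) (Fin n) ℝ => W * signature h) W :=
      contDiffAt_id.matrix_mul contDiffAt_const
    exact h1.matrix_mul contDiffAt_id.matrix_transpose
  · intro U W hU hW
    exact Submonoid.mul_mem _ ((Matrix.mem_orthogonalGroup_iff _ _).2 hU) hW
  · intro U W _ _
    simp [Matrix.mul_assoc]

theorem transpose_mul_of_orthogonal {m : ℕ} {U : Matrix (Fin n) (Fin n) ℝ}
    (hU : U * Uᵀ = 1) (A : Matrix (Fin n) (Fin m) ℝ) : (U * A)ᵀ * (U * A) = Aᵀ * A := by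
  rw [Matrix.transpose_mul, Matrix.mul_assoc, ← Matrix.mul_assoc _ U, mul_eq_one_comm.1 hU,
    Matrix.one_mul]

theorem isQuotientModel_stiefel (h : k ≤ n) : IsQuotientModel
    (fun Y : V k n => Y.1) (fun Q : InvolutionModel k n => Q.1)
    (stiefelMk : V k n → StiefelModel k n) involutionOfStiefel := by
  refine isQuotientModel_of_equivariant (p := fun Y : Matrix (Fin n) (Fin k) ℝ => Yᵀ * Y = 1)
    (f := fun Y => (2 : ℝ) • (Y * Yᵀ) - 1) isQuotientMap_quotient_mk'
    stiefelMk_eq_iff (involutionOfStiefel_surjective h) ?_ involutionOfStiefel_coe ?_ ?_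
  · intro Y _
    have h1 : ContDiffAt ℝ ∞ (fun Y : Matrix (Fin n) (Fin k) ℝ => Y * Yᵀ) Y :=
      contDiffAt_id.matrix_mul contDiffAt_id.matrix_transpose
    exact (h1.const_smul (2 : ℝ)).sub contDiffAt_const
  · intro U Y hU hY
    rwa [transpose_mul_of_orthogonal hU]
  · intro U Y hU _
    simp [mul_sub, sub_mul, hU, Matrix.mul_assoc]

theorem isQuotientModel_fullRank (h : k ≤ n) : IsQuotientModel
    (fun A : FullRank k n => A.1) (fun Q : InvolutionModel k n => Q.1)
    (fullRankMk : FullRank k n → FullRankModel k n) involutionOfFullRank := by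
  refine isQuotientModel_of_equivariant (p := fun A : Matrix (Fin n) (Fin k) ℝ => A.rank = k)
    (f := fun A => (2 : ℝ) • colProj A - 1) isQuotientMap_quotient_mk'
    fullRankMk_eq_iff (involutionOfFullRank_surjective h) ?_ (fun _ => rfl) ?_ ?_
  · intro A hA
    exact ((contDiffAt_colProj (det_transpose_mul_self_ne_zero_iff.2 hA)).const_smul (2 : ℝ)).sub
      contDiffAt_const
  · intro U A hU hA
    rwa [← det_transpose_mul_self_ne_zero_iff, transpose_mul_of_orthogonal hU,
      det_transpose_mul_self_ne_zero_iff]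
  · intro U A hU _
    have h1 : colProj (U * A) = U * colProj A * Uᵀ := by
      rw [colProj, transpose_mul_of_orthogonal hU, colProj, Matrix.transpose_mul]
      simp only [Matrix.mul_assoc]
    simp [h1, mul_sub, sub_mul, hU]

end Grassmann

/-! ### Existence of the smooth structures and the diffeomorphisms. -/

namespace Grassmann

open Set Topology Filter

attribute [local instance] Matrix.normedAddCommGroup Matrix.normedSpace

variable {k n : ℕ}

/-- An eigenbasis of `2P - 1` writes `P` as `Y Yᵀ` with `Z` spanning the complement, so the graph
chart can be centred at `P` itself. -/
theorem nonempty_localParam_projectionModel (h : k ≤ n) (P : ProjectionModel k n) :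
    Nonempty (LocalParam (range fun P : ProjectionModel k n => P.1) (k * (n - k)) P.1) := by
  obtain ⟨W, hW⟩ := involutionOfOrthogonal_surjective h (projectionEquiv k n P)
  have hP : P.1 = (firstColumns h W).1 * (firstColumns h W).1ᵀ := by
    rw [← (projectionEquiv k n).injective hW]
    exact colProj_of_orthonormal (firstColumns h W).2
  rw [show (range fun P : ProjectionModel k n => P.1) = _ from Subtype.range_val, hP]
  exact nonempty_localParam_projection (firstColumns h W).2 (lastColumns_transpose_mul_self h W)
    (firstColumns_transpose_mul_lastColumns h W) (firstColumns_add_lastColumns h W) (by simp)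
    (by simp)

theorem contDiff_two_smul_sub_one : ContDiff ℝ ∞ fun P : Matrix (Fin n) (Fin n) ℝ =>
    (2 : ℝ) • P - 1 :=
  (contDiff_id.const_smul (2 : ℝ)).sub contDiff_const

theorem contDiff_half_smul_one_add : ContDiff ℝ ∞ fun Q : Matrix (Fin n) (Fin n) ℝ =>
    (1 / 2 : ℝ) • (1 + Q) :=
  (contDiff_const.add contDiff_id).const_smul (1 / 2 : ℝ)

theorem nonempty_localParam_involutionModel (h : k ≤ n) (Q : InvolutionModel k n) :
    Nonempty (LocalParam (range fun Q : InvolutionModel k n => Q.1) (k * (n - k)) Q.1) := by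
  have hl : ∀ P : Matrix (Fin n) (Fin n) ℝ, (1 / 2 : ℝ) • (1 + ((2 : ℝ) • P - 1)) = P :=
    fun P => by module
  have hr : ∀ Q : Matrix (Fin n) (Fin n) ℝ, (2 : ℝ) • ((1 / 2 : ℝ) • (1 + Q)) - 1 = Q :=
    fun Q => by module
  obtain ⟨P, rfl⟩ := (projectionEquiv k n).surjective Q
  obtain ⟨A⟩ := nonempty_localParam_projectionModel h P
  have hA := A.nonempty_map contDiff_two_smul_sub_one contDiff_half_smul_one_add hl hr
  have hset : (fun Q : Matrix (Fin n) (Fin n) ℝ => (1 / 2 : ℝ) • (1 + Q)) ⁻¹'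
      (range fun P : ProjectionModel k n => P.1) = range fun Q : InvolutionModel k n => Q.1 := by
    ext Q
    constructor
    · rintro ⟨P, hP : P.1 = (1 / 2 : ℝ) • (1 + Q)⟩
      refine ⟨projectionEquiv k n P, ?_⟩
      change (2 : ℝ) • P.1 - 1 = Q
      rw [hP, hr]
    · rintro ⟨Q, rfl⟩
      exact ⟨(projectionEquiv k n).symm Q, rfl⟩
  rwa [hset] at hA

theorem exists_isInvolutionStructure (h : k ≤ n) : ∃ c, IsInvolutionStructure k n c :=
  exists_isSubmanifoldStructure (ι := fun Q : InvolutionModel k n => Q.1) IsEmbedding.subtypeVal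
    fun Q => (nonempty_localParam_involutionModel h Q).some

theorem exists_isProjectionStructure (h : k ≤ n) : ∃ c, IsProjectionStructure k n c :=
  exists_isSubmanifoldStructure (ι := fun P : ProjectionModel k n => P.1) IsEmbedding.subtypeVal
    fun P => (nonempty_localParam_projectionModel h P).some

theorem exists_stiefel_submanifold (h : k ≤ n) :
    ∃ c, IsSubmanifoldStructure (n * k - k * (k + 1) / 2)
      (fun (Y : V k n) (i : Fin n) (j : Fin k) => Y.1 i j) c := by
  refine exists_isSubmanifoldStructure (ι := fun Y : V k n => Y.1) IsEmbedding.subtypeVal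
    fun Y => Nonempty.some ?_
  rw [show (range fun Y : V k n => Y.1) = _ from Subtype.range_val]
  refine nonempty_localParam_stiefel Y.2 ?_
  -- The subtraction in the dimension does not truncate, because `k + 1 ≤ 2n` when `1 ≤ k ≤ n`.
  have h1 : k * (k + 1) / 2 ≤ n * k := by
    apply Nat.div_le_of_le_mul
    rcases Nat.eq_zero_or_pos k with rfl | _
    · simp
    · calc k * (k + 1) ≤ k * (2 * n) := Nat.mul_le_mul_left k (by omega)
        _ = 2 * (n * k) := by ring
  rw [Nat.choose_two_right, Nat.add_sub_cancel, mul_comm (k + 1) k]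
  omega

theorem exists_orthogonal_submanifold (n : ℕ) :
    ∃ c, IsSubmanifoldStructure (n * (n - 1) / 2)
      (fun (W : O n) (i : Fin n) (j : Fin n) => W.1 i j) c := by
  refine exists_isSubmanifoldStructure (ι := fun W : O n => W.1) IsEmbedding.subtypeVal
    fun W => Nonempty.some ?_
  have hset : (range fun W : O n => W.1) = {W : Matrix (Fin n) (Fin n) ℝ | Wᵀ * W = 1} := by
    ext W
    exact ⟨fun ⟨U, hU⟩ => hU ▸ orthogonal_transpose_mul_self U,
      fun hW => ⟨⟨W, (Matrix.mem_orthogonalGroup_iff' _ _).2 hW⟩, rfl⟩⟩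
  rw [hset]
  refine nonempty_localParam_stiefel (orthogonal_transpose_mul_self W) ?_
  -- The orthogonal group is the case of square frames, and `n² = (n+1).choose 2 + n.choose 2` gives
  -- its dimension.
  rw [← Nat.choose_two_right, Nat.choose_succ_succ' n 1, Nat.choose_one_right, add_assoc, ← two_mul,
    Nat.choose_two_right, Nat.mul_div_cancel' (Nat.even_mul_pred_self n).two_dvd]
  rcases n with _ | n
  · rfl
  · rw [Nat.add_sub_cancel]
    ring

theorem exists_fullRank_submanifold (k n : ℕ) :
    ∃ c, IsSubmanifoldStructure (n * k)
      (fun (A : FullRank k n) (i : Fin n) (j : Fin k) => A.1 i j) c := by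
  refine exists_isSubmanifoldStructure (ι := fun A : FullRank k n => A.1) IsEmbedding.subtypeVal
    fun A => Nonempty.some ?_
  refine LocalParam.nonempty_of_isOpen ?_ (mem_range_self A) (by simp [Module.finrank_matrix])
  rw [show (range fun A : FullRank k n => A.1) = _ from Subtype.range_val]
  -- Full column rank means a nonzero Gram determinant, which is an open condition.
  simp only [← det_transpose_mul_self_ne_zero_iff]
  exact isOpen_det_ne_zero (by fun_prop)

theorem exists_isOrthogonalStructure (h : k ≤ n) : ∃ c, IsOrthogonalStructure h c := by
  obtain ⟨cM, hM⟩ := exists_orthogonal_submanifold n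
  obtain ⟨c, hc⟩ := (isQuotientModel_orthogonal h).exists_isQuotientStructure
    IsEmbedding.subtypeVal (fun Q => (nonempty_localParam_involutionModel h Q).some) hM
  exact ⟨c, cM, hM, hc⟩

theorem exists_isStiefelStructure (h : k ≤ n) : ∃ c, IsStiefelStructure k n c := by
  obtain ⟨cM, hM⟩ := exists_stiefel_submanifold h
  obtain ⟨c, hc⟩ := (isQuotientModel_stiefel h).exists_isQuotientStructure
    IsEmbedding.subtypeVal (fun Q => (nonempty_localParam_involutionModel h Q).some) hM
  exact ⟨c, cM, hM, hc⟩

theorem exists_isFullRankStructure (h : k ≤ n) : ∃ c, IsFullRankStructure k n c := by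
  obtain ⟨cM, hM⟩ := exists_fullRank_submanifold k n
  obtain ⟨c, hc⟩ := (isQuotientModel_fullRank h).exists_isQuotientStructure
    IsEmbedding.subtypeVal (fun Q => (nonempty_localParam_involutionModel h Q).some) hM
  exact ⟨c, cM, hM, hc⟩

/-- The bijection `P ↦ 2P - 1` is a diffeomorphism. -/
theorem exists_projection_diffeomorph
    [cI : ChartedSpace (EuclideanSpace ℝ (Fin (k * (n - k)))) (InvolutionModel k n)]
    (hI : IsInvolutionStructure k n cI)
    [c : ChartedSpace (EuclideanSpace ℝ (Fin (k * (n - k)))) (ProjectionModel k n)]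
    (hc : IsProjectionStructure k n c) :
    ∃ φ : ProjectionModel k n ≃ₘ^∞⟮𝓡 (k * (n - k)), 𝓡 (k * (n - k))⟯ InvolutionModel k n,
      (∀ P, (φ P : Matrix (Fin n) (Fin n) ℝ) = (2 : ℝ) • (P : Matrix (Fin n) (Fin n) ℝ) - 1) ∧
      (∀ Q, (φ.symm Q : Matrix (Fin n) (Fin n) ℝ) =
        (1 / 2 : ℝ) • (1 + (Q : Matrix (Fin n) (Fin n) ℝ))) := by
  refine ⟨⟨projectionEquiv k n, fun P => ?_, fun Q => ?_⟩, fun P => rfl, fun Q => rfl⟩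
  · exact contMDiffAt_of_ambient hc hI (contDiff_two_smul_sub_one (n := n)).contDiffAt
      (Eventually.of_forall fun _ => rfl)
  · exact contMDiffAt_of_ambient hI hc (contDiff_half_smul_one_add (n := n)).contDiffAt
      (Eventually.of_forall fun _ => rfl)

theorem exists_orthogonal_diffeomorph (h : k ≤ n)
    [cI : ChartedSpace (EuclideanSpace ℝ (Fin (k * (n - k)))) (InvolutionModel k n)]
    (hI : IsInvolutionStructure k n cI)
    [c : ChartedSpace (EuclideanSpace ℝ (Fin (k * (n - k)))) (OrthogonalModel h)]
    (hc : IsOrthogonalStructure h c) :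
    ∃ φ : OrthogonalModel h ≃ₘ^∞⟮𝓡 (k * (n - k)), 𝓡 (k * (n - k))⟯ InvolutionModel k n,
      ∀ x, φ (orthogonalMk h x) = involutionOfOrthogonal h x := by
  obtain ⟨cM, hM, hc⟩ := hc
  exact (isQuotientModel_orthogonal h).exists_diffeomorph hM hI hc

theorem exists_stiefel_diffeomorph (h : k ≤ n)
    [cI : ChartedSpace (EuclideanSpace ℝ (Fin (k * (n - k)))) (InvolutionModel k n)]
    (hI : IsInvolutionStructure k n cI)
    [c : ChartedSpace (EuclideanSpace ℝ (Fin (k * (n - k)))) (StiefelModel k n)]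
    (hc : IsStiefelStructure k n c) :
    ∃ φ : StiefelModel k n ≃ₘ^∞⟮𝓡 (k * (n - k)), 𝓡 (k * (n - k))⟯ InvolutionModel k n,
      ∀ x, φ (stiefelMk x) = involutionOfStiefel x := by
  obtain ⟨cM, hM, hc⟩ := hc
  exact (isQuotientModel_stiefel h).exists_diffeomorph hM hI hc

theorem exists_fullRank_diffeomorph (h : k ≤ n)
    [cI : ChartedSpace (EuclideanSpace ℝ (Fin (k * (n - k)))) (InvolutionModel k n)]
    (hI : IsInvolutionStructure k n cI)
    [c : ChartedSpace (EuclideanSpace ℝ (Fin (k * (n - k)))) (FullRankModel k n)]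
    (hc : IsFullRankStructure k n c) :
    ∃ φ : FullRankModel k n ≃ₘ^∞⟮𝓡 (k * (n - k)), 𝓡 (k * (n - k))⟯ InvolutionModel k n,
      ∀ x, φ (fullRankMk x) = involutionOfFullRank x := by
  obtain ⟨cM, hM, hc⟩ := hc
  exact (isQuotientModel_fullRank h).exists_diffeomorph hM hI hc

end Grassmann

theorem proposition2p2 (n k : ℕ) (hk : 1 ≤ k) (hkn : k ≤ n) :
    -- The smooth structures on the five models exist.
    (∃ c, Grassmann.IsInvolutionStructure k n c) ∧
    (∃ c, Grassmann.IsOrthogonalStructure hkn c) ∧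
    (∃ c, Grassmann.IsProjectionStructure k n c) ∧
    (∃ c, Grassmann.IsStiefelStructure k n c) ∧
    (∃ c, Grassmann.IsFullRankStructure k n c) ∧
    -- Eigenvalue decompositions and QR factorizations exist.
    (∀ Q : Grassmann.InvolutionModel k n, ∃ W, Grassmann.IsEigenbasis hkn Q W) ∧
    (∀ A : Grassmann.FullRank k n, ∃ Y R, Grassmann.IsQR A Y R) ∧
    -- With these smooth structures, the four maps are diffeomorphisms onto the involution model.
    ∀ [cI : ChartedSpace (EuclideanSpace ℝ (Fin (k * (n - k)))) (Grassmann.InvolutionModel k n)],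
      Grassmann.IsInvolutionStructure k n cI →
      (∀ [c : ChartedSpace (EuclideanSpace ℝ (Fin (k * (n - k)))) (Grassmann.OrthogonalModel hkn)],
        Grassmann.IsOrthogonalStructure hkn c →
        ∃ φ : Grassmann.OrthogonalModel hkn
            ≃ₘ^∞⟮𝓡 (k * (n - k)), 𝓡 (k * (n - k))⟯ Grassmann.InvolutionModel k n,
          (∀ W : Grassmann.O n,
            (φ (Grassmann.orthogonalMk hkn W) : Matrix (Fin n) (Fin n) ℝ) =
              (W : Matrix (Fin n) (Fin n) ℝ) * Grassmann.signature hkn *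
                (W : Matrix (Fin n) (Fin n) ℝ)ᵀ) ∧
          (∀ Q W, Grassmann.IsEigenbasis hkn Q W → φ.symm Q = Grassmann.orthogonalMk hkn W)) ∧
      (∀ [c : ChartedSpace (EuclideanSpace ℝ (Fin (k * (n - k)))) (Grassmann.ProjectionModel k n)],
        Grassmann.IsProjectionStructure k n c →
        ∃ φ : Grassmann.ProjectionModel k n
            ≃ₘ^∞⟮𝓡 (k * (n - k)), 𝓡 (k * (n - k))⟯ Grassmann.InvolutionModel k n,
          (∀ P, (φ P : Matrix (Fin n) (Fin n) ℝ) = (2 : ℝ) • (P : Matrix (Fin n) (Fin n) ℝ) - 1) ∧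
          (∀ Q, (φ.symm Q : Matrix (Fin n) (Fin n) ℝ) =
            (1 / 2 : ℝ) • (1 + (Q : Matrix (Fin n) (Fin n) ℝ)))) ∧
      (∀ [c : ChartedSpace (EuclideanSpace ℝ (Fin (k * (n - k)))) (Grassmann.StiefelModel k n)],
        Grassmann.IsStiefelStructure k n c →
        ∃ φ : Grassmann.StiefelModel k n
            ≃ₘ^∞⟮𝓡 (k * (n - k)), 𝓡 (k * (n - k))⟯ Grassmann.InvolutionModel k n,
          (∀ Y : Grassmann.V k n,
            (φ (Grassmann.stiefelMk Y) : Matrix (Fin n) (Fin n) ℝ) =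
              (2 : ℝ) • (Y.1 * Y.1ᵀ) - 1) ∧
          (∀ Q W, Grassmann.IsEigenbasis hkn Q W →
            φ.symm Q = Grassmann.stiefelMk (Grassmann.firstColumns hkn W))) ∧
      (∀ [c : ChartedSpace (EuclideanSpace ℝ (Fin (k * (n - k)))) (Grassmann.FullRankModel k n)],
        Grassmann.IsFullRankStructure k n c →
        ∃ φ : Grassmann.FullRankModel k n
            ≃ₘ^∞⟮𝓡 (k * (n - k)), 𝓡 (k * (n - k))⟯ Grassmann.InvolutionModel k n,
          (∀ A Y R, Grassmann.IsQR A Y R →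
            (φ (Grassmann.fullRankMk A) : Matrix (Fin n) (Fin n) ℝ) =
              (2 : ℝ) • (Y.1 * Y.1ᵀ) - 1) ∧
          (∀ Q W, Grassmann.IsEigenbasis hkn Q W →
            φ.symm Q =
              Grassmann.fullRankMk (Grassmann.toFullRank (Grassmann.firstColumns hkn W)))) := by
  refine ⟨Grassmann.exists_isInvolutionStructure hkn, Grassmann.exists_isOrthogonalStructure hkn,
    Grassmann.exists_isProjectionStructure hkn, Grassmann.exists_isStiefelStructure hkn,
    Grassmann.exists_isFullRankStructure hkn, Grassmann.exists_isEigenbasis hkn,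
    Grassmann.exists_isQR, ?_⟩
  intro cI hI
  refine ⟨?_, fun hc => Grassmann.exists_projection_diffeomorph hI hc, ?_, ?_⟩
  · intro c hc
    obtain ⟨φ, hφ⟩ := Grassmann.exists_orthogonal_diffeomorph hkn hI hc
    refine ⟨φ, fun W => ?_, fun Q W hQW => ?_⟩
    · rw [hφ, Grassmann.involutionOfOrthogonal_coe]
    -- An eigenbasis of `Q` is a point of the fibre of `Ψ` over `Q`, so its class is `φ.symm Q`
    -- whichever eigenbasis is chosen.
    · rw [← (Grassmann.isEigenbasis_iff hkn Q W).1 hQW, ← hφ, φ.symm_apply_apply]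
  · intro c hc
    obtain ⟨φ, hφ⟩ := Grassmann.exists_stiefel_diffeomorph hkn hI hc
    refine ⟨φ, fun Y => ?_, fun Q W hQW => ?_⟩
    · rw [hφ, Grassmann.involutionOfStiefel_coe]
    · rw [← (Grassmann.isEigenbasis_iff hkn Q W).1 hQW, Grassmann.involutionOfOrthogonal, ← hφ,
        φ.symm_apply_apply]
  · intro c hc
    obtain ⟨φ, hφ⟩ := Grassmann.exists_fullRank_diffeomorph hkn hI hc
    refine ⟨φ, fun A Y R hAYR => ?_, fun Q W hQW => ?_⟩
    · rw [hφ, Grassmann.involutionOfFullRank_eq_of_isQR hAYR, Grassmann.involutionOfStiefel_coe]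
    · rw [← (Grassmann.isEigenbasis_iff hkn Q W).1 hQW, Grassmann.involutionOfOrthogonal,
        Grassmann.involutionOfStiefel, ← hφ, φ.symm_apply_apply]
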